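/- For $\kappa\in\mathbb C$ let $E_\kappa(z)=\exp(z+\kappa)$, let $F(t)=e^t-1$ for $t\ge 0$, and let $\sigma$ be the shift on sequences $\underline s=(s_1,s_2,\dots)$ of integers. Call $\underline s$ exponentially bounded if there is an $x>0$ with $|s_{k+1}|\le F^{\circ k}(x)$ for all $k\ge 0$, and let $t_{\underline s}=\inf\{x>0:\ \limsup_{n\to\infty}|s_n|/F^{\circ(n-1)}(x)=0\}$ be its minimal potential. For $j\in\mathbb Z$ let $L_{\kappa,j}(z)=\operatorname{Log} z-\kappa+2\pi i j$, with the principal logarithm. For exponentially bounded $\underline s$ and $t>t_{\underline s}$, the dynamic ray $g^\kappa_{\underline s}$ is defined at the potential $t$ if there is a continuous curve $g:[t,\infty)\to\mathbb C$ such that (i) for all sufficiently large $M$ and all $\tau\ge t$, $E_\kappa^{\circ M}(g(\tau))=\lim_{n\to\infty}L_{\kappa,s_{M+1}}\circ\cdots\circ L_{\kappa,s_{M+n}}(F^{\circ(M+n)}(\tau))$, and (ii) for every $k\ge 0$, $E_\kappa^{\circ k}(g(\tau))=F^{\circ k}(\tau)-\kappa+2\pi i s_{k+1}+o(1)$ as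 $\tau\to\infty$. Such a curve is unique, and $g^\kappa_{\underline s}(t):=g(t)$. For a $C^1$-curve $\gamma:(t_0,\infty)\to\mathbb C$ and a point $a\notin\gamma((t_0,\infty))$, the variation number of $\gamma$ around $a$ is $$\alpha(\gamma,a)=\frac1{2\pi}\int_{t_0}^\infty\left|\operatorname{Im}\frac{\gamma'(t)}{\gamma(t)-a}\right|dt\in[0,\infty].$$ **Proposition (Variation Number of Dynamic Rays).** Let $\kappa\in\mathbb C$, let $\underline s$ be an exponentially bounded sequence of integers, and let $z=g^\kappa_{\underline s}(t_0)$ be a point on the dynamic ray at address $\underline s$ with potential $t_0>t_{\underline s}$ (so the ray is defined at $t_0$). Suppose $N\in\{0,1,2,\dots\}$ is such that for all $t\ge F^{\circ N}(t_0)$ $$\left|\frac{(g^\kappa_{\sigma^N\underline s})''(t)}{(g^\kappa_{\sigma^N\underline s})'(t)}\right|<e^{-t/2}.$$ Then $g^\kappa_{\underline s}|_{(t_0,\infty)}$ is a $C^1$-curve which does not pass through $z$, and its variation number around $z$ satisfies $$\alpha\left(g^\kappa_{\underline s}|_{(t_0,\infty)},z\right)\le 2^N .$$ -/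

import Mathlib

open Set Filter Topology MeasureTheory

noncomputable section

namespace ExpRay

/-- The exponential map `E_κ(z) = exp (z + κ)`. -/
def expMap (κ z : ℂ) : ℂ := Complex.exp (z + κ)

/-- The model function for exponential growth, `F(t) = e^t - 1` (used for `t ≥ 0` only). -/
def modelF (t : ℝ) : ℝ := Real.exp t - 1

/-- The shift on sequences of integers. A sequence `s₁ s₂ s₃ …` is stored as
`s : ℕ → ℤ` with `s n` its entry of index `n + 1`. -/
def shift (s : ℕ → ℤ) : ℕ → ℤ := fun n => s (n + 1)

/-- `s` is exponentially bounded: there is `x > 0` with `|s_{k+1}| ≤ F^{∘k}(x)` for all `k`. -/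
def ExpBounded (s : ℕ → ℤ) : Prop :=
  ∃ x : ℝ, 0 < x ∧ ∀ k : ℕ, |(s k : ℝ)| ≤ modelF^[k] x

/-- The minimal potential `t_s`, the infimum of all `x > 0` such that
`|s_{n+1}| / F^{∘n}(x)` has limes superior (equivalently, limit) `0`. -/
def minPotential (s : ℕ → ℤ) : ℝ :=
  sInf {x : ℝ | 0 < x ∧ Tendsto (fun n : ℕ => |(s n : ℝ)| / modelF^[n] x) atTop (𝓝 0)}

/-- The inverse branch `L_{κ,j}(z) = Log z - κ + 2πij` of `E_κ`. -/
def invBranch (κ : ℂ) (j : ℤ) (z : ℂ) : ℂ :=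
  Complex.log z - κ + 2 * Real.pi * Complex.I * (j : ℂ)

/-- The approximation `L_{κ,s₁} ∘ ⋯ ∘ L_{κ,sₙ} (F^{∘n}(t))` of the dynamic ray at address `s`. -/
def rayApprox (κ : ℂ) : ℕ → (ℕ → ℤ) → ℝ → ℂ
  | 0, _, t => (t : ℂ)
  | n + 1, s, t => invBranch κ (s 0) (rayApprox κ n (shift s) (modelF t))

/-- `g` is, on `[t₀, ∞)`, the dynamic ray of `E_κ` at address `s`: the image of `g` under a high
iterate `E_κ^{∘N}` is a ray tail at address `σ^N s` (tails are the limits of the approximations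
`L_{κ,s_{N+1}} ∘ ⋯ ∘ L_{κ,s_{N+n}} ∘ F^{∘n}`), and `g` is obtained from this tail by pulling it
back `N` times along continuous branches of `E_κ⁻¹`, where the branches are fixed by the
asymptotics `t - κ + 2πi s_{k+1} + o(1)` of the ray at address `σ^k s`.
These conditions determine `g` on `[t₀, ∞)`, since two lifts of a curve under `exp` differ by a
constant in `2πiℤ`. -/
structure IsDynRayOn (κ : ℂ) (s : ℕ → ℤ) (t₀ : ℝ) (g : ℝ → ℂ) : Prop where
  continuousOn : ContinuousOn g (Ici t₀)
  tail : ∀ᶠ N : ℕ in atTop, ∀ t ∈ Ici t₀,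
    Tendsto (fun n : ℕ => rayApprox κ n (shift^[N] s) (modelF^[N] t)) atTop
      (𝓝 ((expMap κ)^[N] (g t)))
  asymptotics : ∀ k : ℕ,
    Tendsto (fun t : ℝ => (expMap κ)^[k] (g t)
      - (((modelF^[k] t : ℝ) : ℂ) - κ + 2 * Real.pi * Complex.I * (s k : ℂ))) atTop (𝓝 0)

/-- The dynamic ray at address `s` is defined at the potential `t > t_s`. (The only obstruction is
that, for some `n ≥ 1`, the ray at address `σ^n s` hits the omitted value `0` of `E_κ` at a
potential `≥ F^{∘n}(t)`, so that it cannot be pulled back further.) -/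
def RayDefinedAt (κ : ℂ) (s : ℕ → ℤ) (t : ℝ) : Prop :=
  minPotential s < t ∧ ∃ g : ℝ → ℂ, IsDynRayOn κ s t g

open Classical in
/-- The point `g_s^κ(t)` of potential `t` on the dynamic ray at address `s`
(with the value `0` where the ray is not defined). -/
def dynRay (κ : ℂ) (s : ℕ → ℤ) (t : ℝ) : ℂ :=
  if h : RayDefinedAt κ s t then h.2.choose t else 0

/-- The variation number of the curve `γ|_{(t₀,∞)}` around `a`, a value in `[0, ∞]`:
`(1/2π) ∫_{t₀}^∞ |Im (γ'(t) / (γ(t) - a))| dt`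
(for a `C¹`-curve on `(t₀,∞)` that does not pass through `a`). -/
def variationNumber (γ : ℝ → ℂ) (t₀ : ℝ) (a : ℂ) : ENNReal :=
  ENNReal.ofReal (1 / (2 * Real.pi)) *
    ∫⁻ t in Ioi t₀, ENNReal.ofReal |(deriv γ t / (γ t - a)).im|

end ExpRay

end

namespace ExpRay

/-! ### Growth of the model function -/

/-! For a curve `γ` put `l = γ''/γ'` and let `V` be the integral of `|Im l|`, the variation of the
direction of the tangent. The quotient `w = γ'/(γ - a)` satisfies `w'/w = l - w`. Off the real axis
`arg w` and `Im w` have the same sign, so `|arg w|` grows at rate at most `|Im l| - |Im w|`. Since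
`|arg w| ≤ π`, the integral of `|Im w|` is at most `V + π` (`IsRegularCurve.lintegral_le`).

Pulling back by `exp` and reparametrizing by `F` turns `l` into `1 + e^t (l - γ'/γ) ∘ F`. A change
of variables and the previous estimate with `a = 0` show that the new `V` is at most `2V + π`; thus
`V + π` at most doubles (`IsRegularCurve.lintegral_pullback_le`,
`RayDefinedAt.exists_regular_of_add`). At level `N` the hypothesis gives `V ≤ ∫ e^{-t/2} ≤ 2`, so `V
+ π ≤ 2π`. After `N` pullbacks the variation around `z` is at most `2^N · 2π`.

The analytic work is to show that rays are `C²` with nonvanishing derivative. Tails have derivative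
`exp` of minus a rapidly convergent series of errors (`IsTailFamily.hasDerivAt`), and this series is
again differentiable (`IsTailFamily.hasDerivAt_logSum`). Regularity then passes to the whole ray by
pullback. -/

theorem modelF_strictMono : StrictMono modelF := fun _ _ h =>
  sub_lt_sub_right (Real.exp_lt_exp.2 h) 1

theorem modelF_add_one (t : ℝ) : modelF t + 1 = Real.exp t := by simp [modelF]

theorem le_modelF (t : ℝ) : t ≤ modelF t := by
  have := Real.add_one_le_exp t
  simp only [modelF]; linarith

theorem modelF_quadratic {t : ℝ} (ht : 0 ≤ t) : t + t ^ 2 / 2 ≤ modelF t := by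
  have := Real.quadratic_le_exp_of_nonneg ht
  simp only [modelF]; linarith

theorem modelF_log {u : ℝ} (hu : 0 < u + 1) : modelF (Real.log (u + 1)) = u := by
  simp [modelF, Real.exp_log hu]

theorem continuous_modelF : Continuous modelF := by unfold modelF; fun_prop

theorem continuous_modelF_iterate (n : ℕ) : Continuous modelF^[n] := continuous_modelF.iterate n

theorem hasDerivAt_modelF (t : ℝ) : HasDerivAt modelF (Real.exp t) t :=
  (Real.hasDerivAt_exp t).sub_const 1

theorem iterate_modelF_strictMono (n : ℕ) : StrictMono modelF^[n] := modelF_strictMono.iterate n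

theorem le_iterate_modelF (n : ℕ) (t : ℝ) : t ≤ modelF^[n] t := by
  induction n with
  | zero => simp
  | succ n ih => rw [Function.iterate_succ_apply']; exact ih.trans (le_modelF _)

theorem hasDerivAt_iterate_modelF (n : ℕ) (t : ℝ) :
    HasDerivAt modelF^[n] (Real.exp (∑ i ∈ Finset.range n, modelF^[i] t)) t := by
  induction n with
  | zero => simpa using hasDerivAt_id t
  | succ n ih =>
    rw [Function.iterate_succ', Finset.sum_range_succ, add_comm, Real.exp_add]
    exact (hasDerivAt_modelF _).comp t ih

theorem iterate_modelF_ge {t : ℝ} (ht : 0 < t) (n : ℕ) : t + n * (t ^ 2 / 2) ≤ modelF^[n] t := by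
  induction n with
  | zero => simp
  | succ n ih =>
    rw [Function.iterate_succ_apply']
    have h1 := le_iterate_modelF n t
    have h2 := modelF_quadratic (ht.le.trans h1)
    push_cast
    nlinarith

theorem tendsto_iterate_modelF {t : ℝ} (ht : 0 < t) :
    Tendsto (fun n => modelF^[n] t) atTop atTop := by
  refine tendsto_atTop_mono (iterate_modelF_ge ht) ?_
  exact tendsto_atTop_add_const_left _ _
    (tendsto_natCast_atTop_atTop.atTop_mul_const (by positivity))

/-- Beyond `x` the map expands distances by at least `e^x ≥ 1 + x`. -/
theorem iterate_modelF_sub_ge {x t : ℝ} (hx : 0 < x) (hxt : x < t) (n : ℕ) :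
    (1 + x) ^ n * (t - x) ≤ modelF^[n] t - modelF^[n] x := by
  induction n with
  | zero => simp
  | succ n ih =>
    rw [Function.iterate_succ_apply', Function.iterate_succ_apply']
    set a := modelF^[n] x
    set b := modelF^[n] t
    have ha : x ≤ a := le_iterate_modelF n x
    have hab : 0 ≤ b - a := le_trans (by have := sub_pos.2 hxt; positivity) ih
    have h1 : Real.exp b = Real.exp a * Real.exp (b - a) := by rw [← Real.exp_add]; ring_nf
    have h2 := Real.add_one_le_exp (b - a)
    have h3 := Real.add_one_le_exp a
    have h4 : (1 + x) * (b - a) ≤ modelF b - modelF a := by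
      have h5 : (1 + x) * (b - a) ≤ Real.exp a * (Real.exp (b - a) - 1) :=
        mul_le_mul (by linarith) (by linarith) hab (Real.exp_pos _).le
      simp only [modelF]
      linarith
    refine le_trans ?_ h4
    rw [pow_succ', mul_assoc]
    exact mul_le_mul_of_nonneg_left ih (by linarith)

theorem tendsto_iterate_modelF_sub {x t : ℝ} (hx : 0 < x) (hxt : x < t) :
    Tendsto (fun n => modelF^[n] t - modelF^[n] x) atTop atTop := by
  refine tendsto_atTop_mono (iterate_modelF_sub_ge hx hxt) ?_
  exact (tendsto_pow_atTop_atTop_of_one_lt (by linarith)).atTop_mul_const (sub_pos.2 hxt)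

/-- One further iterate turns diverging differences into vanishing quotients: `F(a)/F(b) ≤
e^{-(b-a)}`. This accounts for the index shift. -/
theorem tendsto_iterate_modelF_div {x t : ℝ} (hx : 0 < x) (hxt : x < t) :
    Tendsto (fun n => modelF^[n] x / modelF^[n] t) atTop (𝓝 0) := by
  rw [← tendsto_add_atTop_iff_nat 1]
  refine squeeze_zero (g := fun n => Real.exp (-(modelF^[n] t - modelF^[n] x))) ?_ ?_
    (Real.tendsto_exp_neg_atTop_nhds_zero.comp (tendsto_iterate_modelF_sub hx hxt))
  · intro n
    exact div_nonneg (hx.le.trans (le_iterate_modelF _ x))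
      ((hx.trans hxt).le.trans (le_iterate_modelF _ t))
  · intro n
    rw [div_le_iff₀ ((hx.trans hxt).trans_le (le_iterate_modelF _ t)),
      Function.iterate_succ_apply', Function.iterate_succ_apply']
    set a := modelF^[n] x
    set b := modelF^[n] t
    have hab : a ≤ b := (iterate_modelF_strictMono n).monotone hxt.le
    have h1 : Real.exp (-(b - a)) * Real.exp b = Real.exp a := by rw [← Real.exp_add]; ring_nf
    have h2 : Real.exp (-(b - a)) ≤ 1 := Real.exp_le_one_iff.2 (by linarith)
    simp only [modelF]
    linarith

theorem two_mul_sum_iterate_modelF_le {t : ℝ} (ht : 10 ≤ t) (j : ℕ) :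
    2 * (∑ i ∈ Finset.range j, modelF^[i] t + j + 2) ≤ modelF^[j] t := by
  induction j with
  | zero => simp; linarith
  | succ j ih =>
    rw [Finset.sum_range_succ, Function.iterate_succ_apply']
    have h1 := ht.trans (le_iterate_modelF j t)
    have h2 := modelF_quadratic (t := modelF^[j] t) (by linarith)
    push_cast
    nlinarith

/-! ### Shifts of addresses -/

theorem shift_iterate_apply (s : ℕ → ℤ) (k j : ℕ) : (shift^[k] s) j = s (k + j) := by
  induction k generalizing s j with
  | zero => simp
  | succ k ih => rw [Function.iterate_succ_apply, ih]; simp only [shift]; congr 1; ring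

theorem ExpBounded.shift {s : ℕ → ℤ} (hs : ExpBounded s) : ExpBounded (shift s) := by
  obtain ⟨x, hx, h⟩ := hs
  exact ⟨modelF x, hx.trans_le (le_modelF x), fun k => h (k + 1)⟩

theorem ExpBounded.exists_lt {s : ℕ → ℤ} (hs : ExpBounded s) {t : ℝ} (ht : minPotential s < t) :
    ∃ x, 0 < x ∧ x < t ∧ Tendsto (fun n : ℕ => |(s n : ℝ)| / modelF^[n] x) atTop (𝓝 0) := by
  obtain ⟨x, hx, h⟩ := hs
  have hne : {x : ℝ | 0 < x ∧
      Tendsto (fun n : ℕ => |(s n : ℝ)| / modelF^[n] x) atTop (𝓝 0)}.Nonempty := by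
    -- The potential `x` itself only keeps the quotients bounded; any larger one forces them to `0`.
    refine ⟨2 * x, by positivity, ?_⟩
    have hpos : ∀ n, 0 < modelF^[n] (2 * x) := fun n =>
      (by positivity : 0 < 2 * x).trans_le (le_iterate_modelF n _)
    exact squeeze_zero (fun n => div_nonneg (abs_nonneg _) (hpos n).le)
      (fun n => div_le_div_of_nonneg_right (h n) (hpos n).le)
      (tendsto_iterate_modelF_div hx (by linarith))
  obtain ⟨y, hy, hyt⟩ := exists_lt_of_csInf_lt hne ht
  exact ⟨y, hy.1, hyt, hy.2⟩

theorem minPotential_shift_lt {s : ℕ → ℤ} (hs : ExpBounded s) {t : ℝ} (ht : minPotential s < t) :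
    minPotential (shift s) < modelF t := by
  obtain ⟨x, hx, hxt, h⟩ := hs.exists_lt ht
  refine lt_of_le_of_lt (csInf_le ⟨0, fun y hy => hy.1.le⟩ ⟨hx.trans_le (le_modelF x), ?_⟩)
    (modelF_strictMono hxt)
  exact h.comp (tendsto_add_atTop_nat 1)

/-! ### Basic properties of dynamic rays -/

theorem continuous_expMap (κ : ℂ) : Continuous (expMap κ) := by unfold expMap; fun_prop

section

variable {κ : ℂ} {s : ℕ → ℤ} {t₀ t₁ : ℝ} {g g' : ℝ → ℂ}

theorem IsDynRayOn.mono (h : IsDynRayOn κ s t₀ g) (h₁ : t₀ ≤ t₁) : IsDynRayOn κ s t₁ g where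
  continuousOn := h.continuousOn.mono (Ici_subset_Ici.2 h₁)
  tail := h.tail.mono fun _ hN t ht => hN t (h₁.trans ht)
  asymptotics := h.asymptotics

theorem IsDynRayOn.congr (h : IsDynRayOn κ s t₀ g) (hg : EqOn g' g (Ici t₀)) :
    IsDynRayOn κ s t₀ g' where
  continuousOn := h.continuousOn.congr hg
  tail := h.tail.mono fun N hN t ht => by rw [hg ht]; exact hN t ht
  asymptotics k := by
    refine (h.asymptotics k).congr' ?_
    filter_upwards [eventually_ge_atTop t₀] with t ht
    rw [hg ht]

theorem IsDynRayOn.continuousOn_iterate (h : IsDynRayOn κ s t₀ g) (k : ℕ) :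
    ContinuousOn (fun t => (expMap κ)^[k] (g t)) (Ici t₀) :=
  ((continuous_expMap κ).iterate k).comp_continuousOn h.continuousOn

/-- Two continuous lifts under `exp` that are asymptotic to each other agree. -/
theorem eqOn_of_exp_eq {f f' : ℝ → ℂ} (hf : ContinuousOn f (Ici t₀))
    (hf' : ContinuousOn f' (Ici t₀)) (he : ∀ t ∈ Ici t₀, Complex.exp (f t) = Complex.exp (f' t))
    (hlim : Tendsto (fun t => f t - f' t) atTop (𝓝 0)) : EqOn f f' (Ici t₀) := by
  have hmem : ∀ t ∈ Ici t₀, ∃ n : ℤ, f t - f' t = n * (2 * Real.pi * Complex.I) := by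
    intro t ht
    have h1 : Complex.exp (f t - f' t) = 1 := by
      rw [Complex.exp_sub, he t ht, div_self (Complex.exp_ne_zero _)]
    exact Complex.exp_eq_one_iff.1 h1
  choose! n hn using hmem
  have hpi := Real.pi_pos
  have him : ∀ t ∈ Ici t₀, (f t - f' t).im / (2 * Real.pi) = n t := by
    intro t ht
    rw [hn t ht]
    simp only [Complex.mul_im, Complex.intCast_re, Complex.intCast_im, Complex.mul_re,
      Complex.I_re, Complex.I_im, Complex.ofReal_re, Complex.ofReal_im]
    simp
  have hc : ContinuousOn n (Ici t₀) := by
    rw [Int.isClosedEmbedding_coe_real.isInducing.continuousOn_iff]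
    refine ContinuousOn.congr (f := fun t => (f t - f' t).im / (2 * Real.pi)) ?_
      (fun t ht => (him t ht).symm)
    exact (Complex.continuous_im.comp_continuousOn (hf.sub hf')).div_const _
  have h0 : ∀ᶠ t in atTop, n t = 0 := by
    have h1 : Tendsto (fun t => (f t - f' t).im / (2 * Real.pi)) atTop (𝓝 0) := by
      simpa using ((Complex.continuous_im.tendsto _).comp hlim).div_const (2 * Real.pi)
    filter_upwards [eventually_ge_atTop t₀, h1.eventually (Ioo_mem_nhds (by norm_num : (-1:ℝ) < 0)
      one_pos)] with t ht h2
    rw [him t ht] at h2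
    have h3 : -1 < n t := by exact_mod_cast h2.1
    have h4 : n t < 1 := by exact_mod_cast h2.2
    omega
  obtain ⟨T, hT0, hT⟩ := (h0.and (eventually_ge_atTop t₀)).exists
  intro t ht
  have h1 := isPreconnected_Ici.constant hc ht (show T ∈ Ici t₀ from hT)
  rw [hT0] at h1
  have := hn t ht
  rw [h1] at this
  simpa [sub_eq_zero] using this

/-- High iterates agree because both are the same limit. Agreement then descends one iterate at a
time, the asymptotics fixing the branch of the logarithm. -/
theorem IsDynRayOn.eqOn (h : IsDynRayOn κ s t₀ g) (h' : IsDynRayOn κ s t₀ g') :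
    EqOn g g' (Ici t₀) := by
  obtain ⟨N, hN, hN'⟩ := (h.tail.and h'.tail).exists
  have key : ∀ k, ∀ m, m + k = N →
      EqOn (fun t => (expMap κ)^[m] (g t)) (fun t => (expMap κ)^[m] (g' t)) (Ici t₀) := by
    intro k
    induction k with
    | zero =>
      rintro m hm t ht
      obtain rfl : m = N := by simpa using hm
      exact tendsto_nhds_unique (hN t ht) (hN' t ht)
    | succ k ih =>
      intro m hm
      have h1 := ih (m + 1) (by omega)
      have h2 := eqOn_of_exp_eq (f := fun t => (expMap κ)^[m] (g t) + κ)
        (f' := fun t => (expMap κ)^[m] (g' t) + κ)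
        ((h.continuousOn_iterate m).add continuousOn_const)
        ((h'.continuousOn_iterate m).add continuousOn_const) ?_ ?_
      · intro t ht
        exact add_right_cancel (h2 ht)
      · intro t ht
        have := h1 ht
        simp only [Function.iterate_succ_apply'] at this
        exact this
      · have := (h.asymptotics m).sub (h'.asymptotics m)
        simpa using this
  exact key N 0 (by simp)

/-- `dynRay` chooses a curve separately for each potential; uniqueness makes all these choices agree
with a single continuous curve. -/
theorem RayDefinedAt.isDynRayOn (h : RayDefinedAt κ s t₀) : IsDynRayOn κ s t₀ (dynRay κ s) := by
  have hg := h.2.choose_spec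
  refine hg.congr fun t ht => ?_
  have hd : RayDefinedAt κ s t := ⟨h.1.trans_le ht, _, hg.mono ht⟩
  rw [dynRay, dif_pos hd]
  exact hd.2.choose_spec.eqOn (hg.mono ht) self_mem_Ici

theorem modelF_add_one_pos_of_le {u : ℝ} (hu : modelF t₀ ≤ u) : 0 < u + 1 := by
  have := Real.exp_pos t₀
  have := modelF_add_one t₀
  linarith

theorem le_log_of_modelF_le {u : ℝ} (hu : modelF t₀ ≤ u) : t₀ ≤ Real.log (u + 1) := by
  rw [Real.le_log_iff_exp_le (modelF_add_one_pos_of_le hu), ← modelF_add_one]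
  linarith

theorem IsDynRayOn.shift (h : IsDynRayOn κ s t₀ g) :
    IsDynRayOn κ (shift s) (modelF t₀) (fun u => expMap κ (g (Real.log (u + 1)))) where
  continuousOn := by
    refine (continuous_expMap κ).comp_continuousOn (h.continuousOn.comp ?_ ?_)
    · exact ContinuousOn.log (by fun_prop) fun u hu => (modelF_add_one_pos_of_le hu).ne'
    · intro u hu
      exact le_log_of_modelF_le hu
  tail := by
    filter_upwards [(tendsto_add_atTop_nat 1).eventually h.tail] with N hN u hu
    have := hN _ (le_log_of_modelF_le hu)
    simpa only [Function.iterate_succ_apply, modelF_log (modelF_add_one_pos_of_le hu)] using this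
  asymptotics k := by
    have hlog : Tendsto (fun u : ℝ => Real.log (u + 1)) atTop atTop :=
      Real.tendsto_log_atTop.comp (tendsto_atTop_add_const_right _ _ tendsto_id)
    refine ((h.asymptotics (k + 1)).comp hlog).congr' ?_
    filter_upwards [eventually_ge_atTop (modelF t₀)] with u hu
    simp only [Function.comp, Function.iterate_succ_apply, modelF_log (modelF_add_one_pos_of_le hu),
      ExpRay.shift]

theorem RayDefinedAt.shift (hs : ExpBounded s) (h : RayDefinedAt κ s t₀) :
    RayDefinedAt κ (shift s) (modelF t₀) :=
  ⟨minPotential_shift_lt hs h.1, _, h.isDynRayOn.shift⟩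

theorem RayDefinedAt.exp_dynRay (hs : ExpBounded s) (h : RayDefinedAt κ s t₀) {t : ℝ}
    (ht : t₀ ≤ t) : dynRay κ (ExpRay.shift s) (modelF t) = Complex.exp (dynRay κ s t + κ) := by
  have h1 := (h.shift hs).isDynRayOn.eqOn h.isDynRayOn.shift
    (modelF_strictMono.monotone ht : modelF t ∈ Ici (modelF t₀))
  rw [h1, modelF_add_one, Real.log_exp, expMap]

theorem ExpBounded.shift_iterate (hs : ExpBounded s) (n : ℕ) :
    ExpBounded (ExpRay.shift^[n] s) := by
  induction n with
  | zero => exact hs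
  | succ n ih => rw [Function.iterate_succ_apply']; exact ih.shift

theorem RayDefinedAt.shift_iterate (hs : ExpBounded s) (h : RayDefinedAt κ s t₀) (n : ℕ) :
    RayDefinedAt κ (ExpRay.shift^[n] s) (modelF^[n] t₀) := by
  induction n with
  | zero => exact h
  | succ n ih =>
    rw [Function.iterate_succ_apply', Function.iterate_succ_apply']
    exact ih.shift (hs.shift_iterate n)

theorem RayDefinedAt.dynRay_iterate (hs : ExpBounded s) (h : RayDefinedAt κ s t₀) {t : ℝ}
    (ht : t₀ ≤ t) (n : ℕ) :
    dynRay κ (ExpRay.shift^[n] s) (modelF^[n] t) = (expMap κ)^[n] (dynRay κ s t) := by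
  induction n with
  | zero => rfl
  | succ n ih =>
    rw [Function.iterate_succ_apply', Function.iterate_succ_apply', Function.iterate_succ_apply',
      (h.shift_iterate hs n).exp_dynRay (hs.shift_iterate n)
        ((iterate_modelF_strictMono n).monotone ht), ih, expMap]

end

end ExpRay

noncomputable section
namespace ExpRay

/-! ### Smoothness of ray tails -/

/-- The entries of `s` are so small, relative to the orbit of any potential `t ≥ t₀`, that all
corrections in the approximation of the ray and its first two derivatives are summable. -/
structure TailBound (κ : ℂ) (s : ℕ → ℤ) (t₀ : ℝ) : Prop where
  pos : 0 < t₀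
  bound : ∀ (j : ℕ) (t : ℝ), t₀ ≤ t →
    4 * (‖κ‖ + 2 * Real.pi * |(s (j + 1) : ℝ)| + 2) * 2 ^ j *
      Real.exp (∑ i ∈ Finset.range j, modelF^[i] t) ≤ Real.exp (modelF^[j] t)

/-- Choose an admissible `x < t₀`. The entry of index `n + 1` is eventually small against
`F^{∘(n+1)}(x) < exp(F^{∘n}(x))`, and `F^{∘n}(x)` is at most half of `F^{∘n}(t₀)`. The other half of
the exponent absorbs the sum over the earlier orbit and the factor `4 · 2^j`. -/
theorem exists_tailBound (κ : ℂ) {s : ℕ → ℤ} (hs : ExpBounded s) {t₀ : ℝ}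
    (ht₀ : minPotential s < t₀) :
    ∀ᶠ K in atTop, TailBound κ (shift^[K] s) (modelF^[K] t₀) := by
  obtain ⟨x, hx, hxt, hlim⟩ := hs.exists_lt ht₀
  have hpi := Real.pi_pos
  have e1 : ∀ᶠ n in atTop, |(s n : ℝ)| / modelF^[n] x < 1 / (4 * Real.pi) :=
    hlim.eventually_lt_const (by positivity)
  have e2 : ∀ᶠ n in atTop, 2 * (‖κ‖ + 2) ≤ modelF^[n] x :=
    (tendsto_iterate_modelF hx).eventually_ge_atTop _
  have e3 : ∀ᶠ n in atTop, modelF^[n] x / modelF^[n] t₀ < 1 / 2 :=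
    (tendsto_iterate_modelF_div hx hxt).eventually_lt_const (by norm_num)
  have e4 : ∀ᶠ n in atTop, 10 ≤ modelF^[n] t₀ :=
    (tendsto_iterate_modelF (hx.trans hxt)).eventually_ge_atTop _
  obtain ⟨K₀, hK₀⟩ := eventually_atTop.1 (e1.and (e2.and (e3.and e4)))
  filter_upwards [eventually_ge_atTop K₀] with K hK
  have h10 := (hK₀ K hK).2.2.2
  refine ⟨by linarith, fun j t ht => ?_⟩
  obtain ⟨-, -, h3, -⟩ := hK₀ (K + j) (by omega)
  obtain ⟨h1, h2, -, -⟩ := hK₀ (K + (j + 1)) (by omega)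
  rw [shift_iterate_apply]
  set n := K + j with hn
  have hxn : 0 < modelF^[K + (j + 1)] x := hx.trans_le (le_iterate_modelF _ _)
  have htn : 0 < modelF^[n] t₀ := (hx.trans hxt).trans_le (le_iterate_modelF _ _)
  rw [div_lt_iff₀ hxn] at h1
  rw [div_lt_iff₀ htn] at h3
  have hA : ‖κ‖ + 2 * Real.pi * |(s (K + (j + 1)) : ℝ)| + 2 ≤ Real.exp (modelF^[n] x) := by
    have h4 : 2 * Real.pi * |(s (K + (j + 1)) : ℝ)| ≤ modelF^[K + (j + 1)] x / 2 := by
      calc 2 * Real.pi * |(s (K + (j + 1)) : ℝ)|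
          ≤ 2 * Real.pi * (1 / (4 * Real.pi) * modelF^[K + (j + 1)] x) := by gcongr
        _ = modelF^[K + (j + 1)] x / 2 := by field_simp; norm_num
    have h5 : modelF^[K + (j + 1)] x + 1 = Real.exp (modelF^[n] x) := by
      rw [← add_assoc, ← hn, Function.iterate_succ_apply', modelF_add_one]
    linarith
  have hF : modelF^[n] t₀ ≤ modelF^[j] t := by
    rw [hn, add_comm K j, Function.iterate_add_apply]
    exact (iterate_modelF_strictMono j).monotone ht
  have hsum := two_mul_sum_iterate_modelF_le (h10.trans ht) j
  have h2e : (2 : ℝ) ≤ Real.exp 1 := by have := Real.add_one_le_exp (1 : ℝ); linarith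
  have h2j : 4 * (2 : ℝ) ^ j ≤ Real.exp (j + 2) := by
    calc 4 * (2 : ℝ) ^ j = 2 ^ (j + 2) := by ring
      _ ≤ Real.exp 1 ^ (j + 2) := by gcongr
      _ = Real.exp (j + 2) := by rw [← Real.exp_nat_mul]; push_cast; ring_nf
  calc 4 * (‖κ‖ + 2 * Real.pi * |(s (K + (j + 1)) : ℝ)| + 2) * 2 ^ j *
      Real.exp (∑ i ∈ Finset.range j, modelF^[i] t)
      = (4 * 2 ^ j) * (‖κ‖ + 2 * Real.pi * |(s (K + (j + 1)) : ℝ)| + 2) *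
        Real.exp (∑ i ∈ Finset.range j, modelF^[i] t) := by ring
    _ ≤ Real.exp (j + 2) * Real.exp (modelF^[n] x) *
        Real.exp (∑ i ∈ Finset.range j, modelF^[i] t) := by gcongr
    _ = Real.exp (j + 2 + modelF^[n] x + ∑ i ∈ Finset.range j, modelF^[i] t) := by
        simp only [Real.exp_add]
    _ ≤ Real.exp (modelF^[j] t) := Real.exp_le_exp.2 (by linarith)

theorem sum_iterate_modelF_succ (j : ℕ) (t : ℝ) :
    ∑ i ∈ Finset.range (j + 1), modelF^[i] t = ∑ i ∈ Finset.range j, modelF^[i] (modelF t) + t := by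
  rw [Finset.sum_range_succ']
  simp [Function.iterate_succ_apply]

/-! ### Finite approximations of ray tails: error bounds and first derivatives. -/

section

variable {κ : ℂ} {s : ℕ → ℤ} {t₀ t : ℝ}

theorem TailBound.shift (h : TailBound κ s t₀) : TailBound κ (shift s) (modelF t₀) := by
  refine ⟨h.pos.trans_le (le_modelF _), fun j u hu => ?_⟩
  have hup := modelF_add_one_pos_of_le hu
  set t := Real.log (u + 1) with ht
  have htu : modelF t = u := modelF_log hup
  have htt : t₀ ≤ t := le_log_of_modelF_le hu
  have hb := h.bound (j + 1) t htt
  rw [sum_iterate_modelF_succ, Function.iterate_succ_apply, htu] at hb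
  refine le_trans ?_ hb
  have hpi := Real.pi_pos
  have h1 : (2 : ℝ) ^ j ≤ 2 ^ (j + 1) := pow_le_pow_right₀ (by norm_num) (by omega)
  have h2 := h.pos
  simp only [ExpRay.shift]
  gcongr
  linarith

theorem TailBound.shift_iterate (h : TailBound κ s t₀) (n : ℕ) :
    TailBound κ (ExpRay.shift^[n] s) (modelF^[n] t₀) := by
  induction n with
  | zero => exact h
  | succ n ih =>
    rw [Function.iterate_succ_apply', Function.iterate_succ_apply']
    exact ih.shift

/-- The deviation of the `m`-th approximation of the ray from its asymptotic line. -/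
def approxErr (κ : ℂ) (m : ℕ) (s : ℕ → ℤ) (t : ℝ) : ℂ :=
  rayApprox κ m s t - (t - κ + 2 * Real.pi * Complex.I * (s 0 : ℂ))

/-- Write the inner approximation as `e^t (1 + q)` with `‖q‖ ≤ A e^{-t} ≤ 1/4`. The new error is
then exactly `log (1 + q)`, of size at most `3/2 ‖q‖`. -/
theorem rayApprox_succ_of_close {m : ℕ} (h : TailBound κ s t₀) (ht : t₀ ≤ t)
    (hc : ‖rayApprox κ m (shift s) (modelF t) - (modelF t + 1 : ℝ)‖ ≤
      ‖κ‖ + 2 * Real.pi * |(s 1 : ℝ)| + 2) :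
    rayApprox κ m (shift s) (modelF t) ∈ Complex.slitPlane ∧
    rayApprox κ m (shift s) (modelF t) = Complex.exp (t + approxErr κ (m + 1) s t) ∧
    ‖approxErr κ (m + 1) s t‖ ≤
      2 * (‖κ‖ + 2 * Real.pi * |(s 1 : ℝ)| + 2) * Real.exp (-t) := by
  set R := rayApprox κ m (shift s) (modelF t) with hR
  set A := ‖κ‖ + 2 * Real.pi * |(s 1 : ℝ)| + 2 with hA
  rw [modelF_add_one] at hc
  have hb : 4 * A ≤ Real.exp t := by simpa [hA] using h.bound 0 t ht
  have he := Real.exp_pos t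
  set q : ℂ := R * (Real.exp (-t) : ℝ) - 1 with hq
  have hRq : R = (Real.exp t : ℝ) * (1 + q) := by
    rw [hq, Real.exp_neg]
    have : (Real.exp t : ℂ) ≠ 0 := by exact_mod_cast he.ne'
    push_cast
    field_simp
    ring
  have hqn : ‖q‖ ≤ A * Real.exp (-t) := by
    have : q = (R - (Real.exp t : ℝ)) * (Real.exp (-t) : ℝ) := by
      rw [hq, sub_mul, ← Complex.ofReal_mul, ← Real.exp_add]; simp
    rw [this, norm_mul, Complex.norm_real, Real.norm_of_nonneg (Real.exp_pos _).le]
    gcongr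
  have hq2 : ‖q‖ ≤ 1 / 4 := by
    refine hqn.trans ?_
    rw [Real.exp_neg, ← div_eq_mul_inv, div_le_iff₀ he]
    linarith
  have hslit : 1 + q ∈ Complex.slitPlane :=
    Complex.mem_slitPlane_of_norm_lt_one (by linarith)
  have hne : 1 + q ≠ 0 := Complex.slitPlane_ne_zero hslit
  have hlog : Complex.log R = t + Complex.log (1 + q) := by
    rw [hRq, Complex.log_ofReal_mul he hne, Real.log_exp]
  have herr : approxErr κ (m + 1) s t = Complex.log (1 + q) := by
    simp only [approxErr, rayApprox, invBranch, ← hR, hlog]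
    ring
  refine ⟨?_, ?_, ?_⟩
  · rw [hRq, Complex.mem_slitPlane_iff]
    simp only [Complex.re_ofReal_mul, Complex.im_ofReal_mul]
    rcases Complex.mem_slitPlane_iff.1 hslit with h1 | h1
    · exact Or.inl (mul_pos he h1)
    · exact Or.inr (mul_ne_zero he.ne' h1)
  · rw [herr, Complex.exp_add, Complex.exp_log hne, hRq, Complex.ofReal_exp]
  · rw [herr]
    have h1 := Complex.norm_log_one_add_half_le_self (z := q) (by linarith)
    have h2 := norm_nonneg q
    linarith

/-- Closeness at the shifted address makes the error at most `1`, which gives closeness again. The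
centre is `t + 1` because `F(t) + 1 = e^t`. -/
theorem rayApprox_close (m : ℕ) (h : TailBound κ s t₀) (ht : t₀ ≤ t) :
    ‖rayApprox κ m s t - (t + 1 : ℝ)‖ ≤ ‖κ‖ + 2 * Real.pi * |(s 0 : ℝ)| + 2 := by
  have hpi := Real.pi_pos
  induction m generalizing s t₀ t with
  | zero =>
    have : rayApprox κ 0 s t - (t + 1 : ℝ) = -1 := by simp [rayApprox]
    rw [this, norm_neg, norm_one]
    have := norm_nonneg κ
    have : 0 ≤ 2 * Real.pi * |(s 0 : ℝ)| := by positivity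
    linarith
  | succ m ih =>
    have h1 := (rayApprox_succ_of_close h ht
      (ih h.shift (modelF_strictMono.monotone ht))).2.2
    have hb : 4 * (‖κ‖ + 2 * Real.pi * |(s 1 : ℝ)| + 2) ≤ Real.exp t := by
      simpa using h.bound 0 t ht
    have h2 : ‖approxErr κ (m + 1) s t‖ ≤ 1 := by
      refine h1.trans ?_
      rw [Real.exp_neg, ← div_eq_mul_inv, div_le_iff₀ (Real.exp_pos _)]
      have := Real.exp_pos t
      linarith
    have h3 : rayApprox κ (m + 1) s t - (t + 1 : ℝ) =
        approxErr κ (m + 1) s t - κ + 2 * Real.pi * Complex.I * (s 0 : ℂ) - 1 := by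
      simp only [approxErr]; push_cast; ring
    have h4 : ‖2 * Real.pi * Complex.I * (s 0 : ℂ)‖ = 2 * Real.pi * |(s 0 : ℝ)| := by
      simp [abs_of_pos hpi]
    rw [h3]
    calc _ ≤ ‖approxErr κ (m + 1) s t‖ + ‖κ‖ + ‖2 * Real.pi * Complex.I * (s 0 : ℂ)‖ + ‖(1 : ℂ)‖ :=
          (norm_sub_le _ _).trans (by gcongr; exact (norm_add_le _ _).trans (by gcongr; exact norm_sub_le _ _))
      _ ≤ _ := by rw [h4, norm_one]; linarith

theorem TailBound.rayApprox_succ (m : ℕ) (h : TailBound κ s t₀) (ht : t₀ ≤ t) :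
    rayApprox κ m (ExpRay.shift s) (modelF t) ∈ Complex.slitPlane ∧
    rayApprox κ m (ExpRay.shift s) (modelF t) = Complex.exp (t + approxErr κ (m + 1) s t) ∧
    ‖approxErr κ (m + 1) s t‖ ≤
      2 * (‖κ‖ + 2 * Real.pi * |(s 1 : ℝ)| + 2) * Real.exp (-t) :=
  rayApprox_succ_of_close h ht
    (rayApprox_close m h.shift (modelF_strictMono.monotone ht))

/-- At each step `F` contributes the factor `e^t` and the logarithm divides by `e^{t + error}`,
leaving `exp(-error)`. -/
theorem TailBound.hasDerivAt_rayApprox (m : ℕ) (h : TailBound κ s t₀) (ht : t₀ ≤ t) :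
    HasDerivAt (rayApprox κ m s) (Complex.exp (-∑ j ∈ Finset.range m,
      approxErr κ (m - j) (ExpRay.shift^[j] s) (modelF^[j] t))) t := by
  induction m generalizing s t₀ t with
  | zero =>
    simp only [Finset.range_zero, Finset.sum_empty, neg_zero, Complex.exp_zero]
    exact Complex.ofRealCLM.hasDerivAt
  | succ m ih =>
    obtain ⟨h1, h2, -⟩ := h.rayApprox_succ m ht
    have h3 := (ih h.shift (modelF_strictMono.monotone ht)).scomp t (hasDerivAt_modelF t)
    have h4 := ((h3.clog_real h1).sub_const κ).add_const
      (2 * Real.pi * Complex.I * (s 0 : ℂ))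
    refine h4.congr_deriv ?_
    rw [Finset.sum_range_succ', Function.comp, h2, Complex.real_smul, neg_add, Complex.exp_add,
      Complex.exp_add, Complex.ofReal_exp]
    simp only [Function.iterate_succ_apply, Function.iterate_zero_apply, Nat.add_sub_add_right,
      Nat.sub_zero]
    rw [Complex.exp_neg (approxErr κ (m + 1) s t)]
    have := Complex.exp_ne_zero t
    field_simp

/-- The weight is the derivative of `F^{∘j}`; with it the bound also controls the differentiated
error series. -/
theorem TailBound.approxErr_iterate (h : TailBound κ s t₀) (ht : t₀ ≤ t) (m j : ℕ) :
    ‖approxErr κ (m + 1) (ExpRay.shift^[j] s) (modelF^[j] t)‖ *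
      Real.exp (∑ i ∈ Finset.range j, modelF^[i] t) ≤ (1 / 2) ^ (j + 1) := by
  have h1 := ((h.shift_iterate j).rayApprox_succ m ((iterate_modelF_strictMono j).monotone ht)).2.2
  rw [shift_iterate_apply] at h1
  have h2 := h.bound j t ht
  set A := ‖κ‖ + 2 * Real.pi * |(s (j + 1) : ℝ)| + 2
  set S := Real.exp (∑ i ∈ Finset.range j, modelF^[i] t)
  have hS : 0 < S := Real.exp_pos _
  calc _ ≤ 2 * A * Real.exp (-modelF^[j] t) * S := by gcongr
    _ = (4 * A * 2 ^ j * S) * Real.exp (-modelF^[j] t) * (1 / 2) ^ (j + 1) := by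
      rw [one_div, inv_pow, pow_succ]; field_simp; ring
    _ ≤ Real.exp (modelF^[j] t) * Real.exp (-modelF^[j] t) * (1 / 2) ^ (j + 1) := by gcongr
    _ = (1 / 2) ^ (j + 1) := by rw [← Real.exp_add]; simp

theorem one_le_exp_sum_iterate (ht : 0 ≤ t) (j : ℕ) :
    1 ≤ Real.exp (∑ i ∈ Finset.range j, modelF^[i] t) :=
  Real.one_le_exp (Finset.sum_nonneg fun i _ => ht.trans (le_iterate_modelF i t))

end

/-! ### Limits of the approximations: tails are twice continuously differentiable. -/

/-- A family of ray tails `γ k` at the addresses `σ^k s`. -/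
structure IsTailFamily (κ : ℂ) (s : ℕ → ℤ) (t₀ : ℝ) (γ : ℕ → ℝ → ℂ) : Prop where
  tailBound : TailBound κ s t₀
  tendsto : ∀ (k : ℕ) (u : ℝ), modelF^[k] t₀ ≤ u →
    Tendsto (fun n => rayApprox κ n (shift^[k] s) u) atTop (𝓝 (γ k u))
  continuousOn : ∀ k, ContinuousOn (γ k) (Ici (modelF^[k] t₀))

/-- The deviation of the `j`-th ray tail from its asymptotic line at the potential `F^{∘j}(t)`. -/
def tailErr (κ : ℂ) (s : ℕ → ℤ) (γ : ℕ → ℝ → ℂ) (j : ℕ) (t : ℝ) : ℂ :=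
  γ j (modelF^[j] t) - (modelF^[j] t - κ + 2 * Real.pi * Complex.I * (s j : ℂ))

/-- The logarithmic derivative series: `γ 0` has derivative `exp (- logSum)`. -/
def logSum (κ : ℂ) (s : ℕ → ℤ) (γ : ℕ → ℝ → ℂ) (t : ℝ) : ℂ := ∑' j, tailErr κ s γ j t

section

variable {κ : ℂ} {s : ℕ → ℤ} {t₀ t : ℝ} {γ : ℕ → ℝ → ℂ}

theorem IsTailFamily.shift (h : IsTailFamily κ s t₀ γ) (k : ℕ) :
    IsTailFamily κ (ExpRay.shift^[k] s) (modelF^[k] t₀) (fun i => γ (k + i)) where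
  tailBound := h.tailBound.shift_iterate k
  tendsto i u hu := by
    rw [← Function.iterate_add_apply, add_comm] at hu ⊢
    exact h.tendsto (k + i) u hu
  continuousOn i := by
    rw [← Function.iterate_add_apply, add_comm i k]
    exact h.continuousOn (k + i)

theorem tailErr_shift (k j : ℕ) (t : ℝ) :
    tailErr κ (ExpRay.shift^[k] s) (fun i => γ (k + i)) j (modelF^[k] t) =
      tailErr κ s γ (k + j) t := by
  simp only [tailErr, ← Function.iterate_add_apply, shift_iterate_apply, add_comm j k]

theorem IsTailFamily.tendsto_approxErr (h : IsTailFamily κ s t₀ γ) (ht : t₀ ≤ t) (j : ℕ) :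
    Tendsto (fun m => approxErr κ m (ExpRay.shift^[j] s) (modelF^[j] t)) atTop
      (𝓝 (tailErr κ s γ j t)) := by
  have h1 := h.tendsto j (modelF^[j] t) ((iterate_modelF_strictMono j).monotone ht)
  have h2 := h1.sub_const (modelF^[j] t - κ + 2 * Real.pi * Complex.I * (s j : ℂ))
  simpa only [tailErr, approxErr, shift_iterate_apply, add_zero] using h2

theorem IsTailFamily.tailErr_le (h : IsTailFamily κ s t₀ γ) (ht : t₀ ≤ t) (j : ℕ) :
    ‖tailErr κ s γ j t‖ * Real.exp (∑ i ∈ Finset.range j, modelF^[i] t) ≤ (1 / 2) ^ (j + 1) :=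
  le_of_tendsto (((h.tendsto_approxErr ht j).comp (tendsto_add_atTop_nat 1)).norm.mul_const _)
    (Eventually.of_forall fun m => h.tailBound.approxErr_iterate ht m j)

theorem IsTailFamily.tailErr_le' (h : IsTailFamily κ s t₀ γ) (ht : t₀ ≤ t) (j : ℕ) :
    ‖tailErr κ s γ j t‖ ≤ (1 / 2) ^ (j + 1) :=
  (le_mul_of_one_le_right (norm_nonneg _)
    (one_le_exp_sum_iterate (h.tailBound.pos.le.trans ht) j)).trans (h.tailErr_le ht j)

theorem summable_half_pow_succ : Summable fun j : ℕ => (1 / 2 : ℝ) ^ (j + 1) :=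
  (summable_nat_add_iff 1).2 summable_geometric_two

theorem tsum_half_pow_succ (k : ℕ) : ∑' j : ℕ, (1 / 2 : ℝ) ^ (k + j + 1) = (1 / 2) ^ k := by
  have : ∀ j, (1 / 2 : ℝ) ^ (k + j + 1) = (1 / 2) ^ (k + 1) * (1 / 2) ^ j := fun j => by ring
  simp_rw [this]
  rw [tsum_mul_left, tsum_geometric_two, pow_succ]
  ring

theorem IsTailFamily.summable_tailErr (h : IsTailFamily κ s t₀ γ) (ht : t₀ ≤ t) :
    Summable fun j => tailErr κ s γ j t :=
  summable_half_pow_succ.of_norm_bounded (h.tailErr_le' ht)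

theorem IsTailFamily.continuousOn_tailErr (h : IsTailFamily κ s t₀ γ) (j : ℕ) :
    ContinuousOn (tailErr κ s γ j) (Ici t₀) := by
  have hF := continuous_modelF_iterate j
  have h1 : ContinuousOn (fun t => γ j (modelF^[j] t)) (Ici t₀) :=
    (h.continuousOn j).comp hF.continuousOn
      fun t ht => (iterate_modelF_strictMono j).monotone ht
  exact h1.sub (Continuous.continuousOn (by fun_prop))

theorem IsTailFamily.continuousOn_logSum (h : IsTailFamily κ s t₀ γ) :
    ContinuousOn (logSum κ s γ) (Ici t₀) :=
  continuousOn_tsum h.continuousOn_tailErr summable_half_pow_succ fun j _ ht => h.tailErr_le' ht j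

theorem norm_sum_approxErr_le (h : TailBound κ s t₀) (ht : t₀ ≤ t) (m : ℕ) :
    ‖∑ j ∈ Finset.range m, approxErr κ (m - j) (ExpRay.shift^[j] s) (modelF^[j] t)‖ ≤ 1 := by
  calc _ ≤ ∑ j ∈ Finset.range m, (1 / 2 : ℝ) ^ (j + 1) := by
        refine norm_sum_le_of_le _ fun j hj => ?_
        obtain ⟨d, hd⟩ := Nat.exists_eq_add_of_lt (Finset.mem_range.1 hj)
        rw [show m - j = d + 1 by omega]
        refine le_trans (le_mul_of_one_le_right (norm_nonneg _) ?_) (h.approxErr_iterate ht d j)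
        exact one_le_exp_sum_iterate (h.pos.le.trans ht) j
    _ ≤ ∑' j : ℕ, (1 / 2 : ℝ) ^ (j + 1) :=
        summable_half_pow_succ.sum_le_tsum _ fun _ _ => by positivity
    _ = 1 := by simpa using tsum_half_pow_succ 0

/-- Both the terms and their number vary with `m`; extending by zero reduces this to dominated
convergence for series. -/
theorem IsTailFamily.tendsto_sum_approxErr (h : IsTailFamily κ s t₀ γ) (ht : t₀ ≤ t) :
    Tendsto (fun m => ∑ j ∈ Finset.range m,
      approxErr κ (m - j) (ExpRay.shift^[j] s) (modelF^[j] t)) atTop (𝓝 (logSum κ s γ t)) := by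
  have key : Tendsto (fun m => ∑' j, if j < m then
      approxErr κ (m - j) (ExpRay.shift^[j] s) (modelF^[j] t) else 0) atTop
      (𝓝 (logSum κ s γ t)) := by
    refine tendsto_tsum_of_dominated_convergence summable_half_pow_succ (fun j => ?_)
      (Eventually.of_forall fun m j => ?_)
    · refine ((h.tendsto_approxErr ht j).comp (tendsto_sub_atTop_nat j)).congr' ?_
      filter_upwards [eventually_gt_atTop j] with m hm
      simp [hm]
    · split_ifs with hj
      · obtain ⟨d, hd⟩ := Nat.exists_eq_add_of_lt hj
        rw [show m - j = d + 1 by omega]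
        refine le_trans (le_mul_of_one_le_right (norm_nonneg _) ?_)
          (h.tailBound.approxErr_iterate ht d j)
        exact one_le_exp_sum_iterate (h.tailBound.pos.le.trans ht) j
      · simp only [norm_zero]; positivity
  refine key.congr fun m => ?_
  rw [tsum_eq_sum (s := Finset.range m)]
  · exact Finset.sum_congr rfl fun j hj => if_pos (Finset.mem_range.1 hj)
  · intro j hj
    exact if_neg (by simpa using hj)

/-- The fundamental theorem of calculus for the approximations passes to the limit: their
derivatives converge pointwise and are bounded by `e`, so uniform convergence is not needed. -/
theorem IsTailFamily.integral_eq (h : IsTailFamily κ s t₀ γ) (ht : t₀ ≤ t) :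
    ∫ u in t₀..t, Complex.exp (-logSum κ s γ u) = γ 0 t - γ 0 t₀ := by
  set p : ℕ → ℝ → ℂ := fun m u => Complex.exp (-∑ j ∈ Finset.range m,
      approxErr κ (m - j) (ExpRay.shift^[j] s) (modelF^[j] u)) with hp
  have hsub : uIcc t₀ t ⊆ Ici t₀ := by rw [uIcc_of_le ht]; exact Icc_subset_Ici_self
  have hcont : ∀ m, ContinuousOn (p m) (Ici t₀) := by
    intro m
    refine Complex.continuous_exp.comp_continuousOn (ContinuousOn.neg ?_)
    refine continuousOn_finsetSum _ fun j _ => ?_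
    have hR : ContinuousOn (rayApprox κ (m - j) (ExpRay.shift^[j] s)) (Ici (modelF^[j] t₀)) :=
      fun u hu => ((h.tailBound.shift_iterate j).hasDerivAt_rayApprox (m - j)
        hu).continuousAt.continuousWithinAt
    have hF := continuous_modelF_iterate j
    have h1 : ContinuousOn (fun u => rayApprox κ (m - j) (ExpRay.shift^[j] s) (modelF^[j] u))
        (Ici t₀) := hR.comp hF.continuousOn fun u hu => (iterate_modelF_strictMono j).monotone hu
    exact h1.sub (Continuous.continuousOn (by fun_prop))
  have h1 : ∀ m, ∫ u in t₀..t, p m u = rayApprox κ m s t - rayApprox κ m s t₀ := fun m =>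
    intervalIntegral.integral_eq_sub_of_hasDerivAt
      (fun u hu => h.tailBound.hasDerivAt_rayApprox m (hsub hu))
      ((hcont m).mono hsub).intervalIntegrable
  have h2 : Tendsto (fun m => ∫ u in t₀..t, p m u) atTop
      (𝓝 (∫ u in t₀..t, Complex.exp (-logSum κ s γ u))) := by
    refine intervalIntegral.tendsto_integral_filter_of_dominated_convergence
      (fun _ => Real.exp 1) ?_ ?_ (by simp) ?_
    · refine Eventually.of_forall fun m => ?_
      exact (((hcont m).mono hsub).mono uIoc_subset_uIcc).aestronglyMeasurable measurableSet_uIoc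
    · refine Eventually.of_forall fun m => Eventually.of_forall fun u hu => ?_
      rw [hp, Complex.norm_exp]
      refine Real.exp_le_exp.2 ((Complex.re_le_norm _).trans ?_)
      rw [norm_neg]
      exact norm_sum_approxErr_le h.tailBound (hsub (uIoc_subset_uIcc hu)) m
    · refine Eventually.of_forall fun u hu => ?_
      exact (Complex.continuous_exp.tendsto _).comp
        (h.tendsto_sum_approxErr (hsub (uIoc_subset_uIcc hu))).neg
  refine tendsto_nhds_unique h2 ?_
  simp_rw [h1]
  exact (h.tendsto 0 t ht).sub (h.tendsto 0 t₀ le_rfl)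

theorem IsTailFamily.hasDerivAt (h : IsTailFamily κ s t₀ γ) (ht : t₀ < t) :
    HasDerivAt (γ 0) (Complex.exp (-logSum κ s γ t)) t := by
  have hc : ContinuousOn (fun u => Complex.exp (-logSum κ s γ u)) (Ici t₀) :=
    Complex.continuous_exp.comp_continuousOn h.continuousOn_logSum.neg
  have h1 : HasDerivAt (fun t => ∫ u in t₀..t, Complex.exp (-logSum κ s γ u))
      (Complex.exp (-logSum κ s γ t)) t := by
    refine intervalIntegral.integral_hasDerivAt_right ?_ ?_ (hc.continuousAt (Ici_mem_nhds ht))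
    · exact (hc.mono (by rw [uIcc_of_le ht.le]; exact Icc_subset_Ici_self)).intervalIntegrable
    · exact (hc.mono Ioi_subset_Ici_self).stronglyMeasurableAtFilter isOpen_Ioi t ht
  refine (h1.add_const (γ 0 t₀)).congr_of_eventuallyEq ?_
  filter_upwards [Ioi_mem_nhds ht] with u hu
  rw [h.integral_eq (le_of_lt hu)]
  ring

theorem logSum_shift (k : ℕ) (t : ℝ) :
    logSum κ (ExpRay.shift^[k] s) (fun i => γ (k + i)) (modelF^[k] t) =
      ∑' j, tailErr κ s γ (k + j) t := by
  simp only [logSum, tailErr_shift]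

theorem IsTailFamily.hasDerivAt_tailErr (h : IsTailFamily κ s t₀ γ) (ht : t₀ < t) (k : ℕ) :
    HasDerivAt (tailErr κ s γ k)
      (Real.exp (∑ i ∈ Finset.range k, modelF^[i] t) •
        (Complex.exp (-∑' j, tailErr κ s γ (k + j) t) - 1)) t := by
  have h1 := (h.shift k).hasDerivAt (iterate_modelF_strictMono k ht)
  rw [logSum_shift] at h1
  have h2 := h1.scomp t (hasDerivAt_iterate_modelF k t)
  have h3 : HasDerivAt (fun t => ((modelF^[k] t : ℝ) : ℂ))
      (Real.exp (∑ i ∈ Finset.range k, modelF^[i] t) : ℝ) t :=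
    (hasDerivAt_iterate_modelF k t).ofReal_comp
  have h4 := h2.sub ((h3.sub_const κ).add_const (2 * Real.pi * Complex.I * (s k : ℂ)))
  refine h4.congr_deriv ?_
  simp only [Complex.real_smul]
  ring

/-- The weight at index `k` is at most the weight at `k + j`, so the weighted remainder of the
series is at most `2^{-k}`; then `|e^{-L} - 1| ≤ 2|L|` for `|L| ≤ 1`. -/
theorem IsTailFamily.norm_deriv_tailErr_le (h : IsTailFamily κ s t₀ γ) (ht : t₀ ≤ t) (k : ℕ) :
    ‖Real.exp (∑ i ∈ Finset.range k, modelF^[i] t) •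
        (Complex.exp (-∑' j, tailErr κ s γ (k + j) t) - 1)‖ ≤ 2 * (1 / 2) ^ k := by
  set S : ℕ → ℝ := fun k => Real.exp (∑ i ∈ Finset.range k, modelF^[i] t) with hS
  have ht0 : 0 ≤ t := h.tailBound.pos.le.trans ht
  have hsum : Summable fun j : ℕ => (1 / 2 : ℝ) ^ (k + j + 1) := by
    refine ((summable_nat_add_iff (k + 1)).2 summable_geometric_two).congr fun j => ?_
    ring
  have h1 : ∀ j, ‖tailErr κ s γ (k + j) t‖ * S k ≤ (1 / 2) ^ (k + j + 1) := by
    intro j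
    refine le_trans ?_ (h.tailErr_le ht (k + j))
    refine mul_le_mul_of_nonneg_left (Real.exp_le_exp.2 ?_) (norm_nonneg _)
    exact Finset.sum_le_sum_of_subset_of_nonneg (Finset.range_subset_range.2 (by omega))
      fun i _ _ => ht0.trans (le_iterate_modelF i t)
  have h2 : ‖(∑' j, tailErr κ s γ (k + j) t) * (S k : ℂ)‖ ≤ (1 / 2) ^ k := by
    rw [← tsum_mul_right, ← tsum_half_pow_succ k]
    refine tsum_of_norm_bounded hsum.hasSum fun j => ?_
    rw [norm_mul, Complex.norm_real, Real.norm_of_nonneg (Real.exp_pos _).le]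
    exact h1 j
  have hSk : 1 ≤ S k := one_le_exp_sum_iterate ht0 k
  rw [norm_mul, Complex.norm_real, Real.norm_of_nonneg (Real.exp_pos _).le] at h2
  set L := ∑' j, tailErr κ s γ (k + j) t
  have h3 : ‖-L‖ ≤ 1 := by
    rw [norm_neg]
    calc ‖L‖ ≤ ‖L‖ * S k := le_mul_of_one_le_right (norm_nonneg _) hSk
      _ ≤ (1 / 2) ^ k := h2
      _ ≤ 1 := pow_le_one₀ (by norm_num) (by norm_num)
  have h4 := Complex.norm_exp_sub_one_le h3
  rw [norm_neg] at h4
  rw [norm_smul, Real.norm_of_nonneg (Real.exp_pos _).le]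
  calc S k * ‖Complex.exp (-L) - 1‖ ≤ S k * (2 * ‖L‖) := by gcongr
    _ = 2 * (‖L‖ * S k) := by ring
    _ ≤ _ := by gcongr

/-- The derivative of `logSum`. -/
def logSumDeriv (κ : ℂ) (s : ℕ → ℤ) (γ : ℕ → ℝ → ℂ) (t : ℝ) : ℂ :=
  ∑' k, Real.exp (∑ i ∈ Finset.range k, modelF^[i] t) •
    (Complex.exp (-∑' j, tailErr κ s γ (k + j) t) - 1)

theorem IsTailFamily.hasDerivAt_logSum (h : IsTailFamily κ s t₀ γ) (ht : t₀ < t) :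
    HasDerivAt (logSum κ s γ) (logSumDeriv κ s γ t) t :=
  hasDerivAt_tsum_of_isPreconnected (summable_geometric_two.mul_left 2) isOpen_Ioi
    isPreconnected_Ioi (fun k _ hu => h.hasDerivAt_tailErr hu k)
    (fun k _ hu => h.norm_deriv_tailErr_le (le_of_lt hu) k) ht (h.summable_tailErr ht.le) ht

theorem IsTailFamily.continuousOn_logSumDeriv (h : IsTailFamily κ s t₀ γ) :
    ContinuousOn (logSumDeriv κ s γ) (Ici t₀) := by
  refine continuousOn_tsum (fun k => ?_) (summable_geometric_two.mul_left 2)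
    (fun k t ht => h.norm_deriv_tailErr_le ht k)
  have h1 : ContinuousOn (fun t => ∑' j, tailErr κ s γ (k + j) t) (Ici t₀) := by
    refine continuousOn_tsum (fun j => h.continuousOn_tailErr (k + j))
      ((summable_nat_add_iff (k + 1)).2 summable_geometric_two) fun j t ht => ?_
    refine (h.tailErr_le' ht (k + j)).trans_eq ?_
    ring
  have h2 : Continuous fun t => ∑ i ∈ Finset.range k, modelF^[i] t :=
    continuous_finsetSum _ fun i _ => continuous_modelF_iterate i
  exact (Real.continuous_exp.comp h2).continuousOn.smul
    ((Complex.continuous_exp.comp_continuousOn h1.neg).sub continuousOn_const)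

end

end ExpRay
end

noncomputable section
namespace ExpRay

/-! ### Total variation of the argument -/

/-- `γ` is a regular `C²`-curve on `(t₀, ∞)` with derivative `d` and logarithmic second
derivative `l = γ'' / γ'`. -/
structure IsRegularCurve (γ : ℝ → ℂ) (t₀ : ℝ) (d l : ℝ → ℂ) : Prop where
  hasDerivAt : ∀ t, t₀ < t → HasDerivAt γ (d t) t
  ne_zero : ∀ t, t₀ < t → d t ≠ 0
  hasDerivAt_deriv : ∀ t, t₀ < t → HasDerivAt d (d t * l t) t
  continuousOn : ContinuousOn l (Ioi t₀)

/-- `arg` jumps across the negative axis, but its absolute value is the unoriented angle with `1`.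
-/
theorem continuousAt_abs_arg {w : ℂ} (hw : w ≠ 0) : ContinuousAt (fun z : ℂ => |z.arg|) w := by
  have h1 : ContinuousAt (fun z : ℂ => InnerProductGeometry.angle 1 z) w :=
    (InnerProductGeometry.continuousAt_angle (x := ((1 : ℂ), w)) one_ne_zero hw).comp
      (f := fun z : ℂ => ((1 : ℂ), z)) (by fun_prop)
  refine h1.congr ?_
  filter_upwards [isOpen_ne.mem_nhds hw] with z hz
  exact Complex.angle_one_left hz

theorem hasDerivAt_arg {w : ℝ → ℂ} {w' : ℂ} {t : ℝ} (hw : HasDerivAt w w' t)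
    (hs : w t ∈ Complex.slitPlane) :
    HasDerivAt (fun u => (w u).arg) (w' / w t).im t := by
  have h1 := (Complex.imCLM.hasFDerivAt.comp_hasDerivAt t (hw.clog_real hs))
  refine h1.congr_of_eventuallyEq ?_
  exact Eventually.of_forall fun u => (Complex.log_im (w u)).symm

/-- If `w' / w = l - w`, then `|Im w|` is bounded by `|Im l|` up to the growth of `|arg w|`. -/
theorem frequently_slope_abs_arg_lt {w : ℝ → ℂ} {l : ℂ} {t r : ℝ} (hw0 : w t ≠ 0)
    (hw : HasDerivAt w (w t * (l - w t)) t) (hr : |l.im| - |(w t).im| < r) :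
    ∃ᶠ z in 𝓝[>] t, slope (fun u => |(w u).arg|) t z < r := by
  refine Eventually.frequently ?_
  have hdiv : w t * (l - w t) / w t = l - w t := by field_simp
  by_cases hs : w t ∈ Complex.slitPlane
  · have harg := hasDerivAt_arg hw hs
    rw [hdiv, Complex.sub_im] at harg
    have hgt : (𝓝[>] t) ≤ 𝓝[≠] t := nhdsWithin_mono _ fun x hx => ne_of_gt hx
    have hslope := (hasDerivAt_iff_tendsto_slope.1 harg).mono_left hgt
    rcases lt_trichotomy (w t).im 0 with him | him | him
    · have hlt : (w t).arg < 0 := Complex.arg_neg_iff.2 him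
      have hev : ∀ᶠ u in 𝓝 t, (w u).arg < 0 := harg.continuousAt.eventually_lt_const hlt
      rw [abs_of_neg him] at hr
      have h2 : -(l.im - (w t).im) < r := by have := neg_abs_le l.im; linarith
      filter_upwards [hslope.neg.eventually_lt_const h2, nhdsWithin_le_nhds hev] with z hz1 hz2
      refine lt_of_eq_of_lt ?_ hz1
      simp only [slope_def_field, abs_of_neg hlt, abs_of_neg hz2]
      ring
    · have h0 : (w t).arg = 0 := by
        rw [Complex.arg_eq_zero_iff]
        rcases Complex.mem_slitPlane_iff.1 hs with h | h
        · exact ⟨h.le, him⟩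
        · exact absurd him h
      rw [him, abs_zero, sub_zero] at hr
      rw [him, sub_zero] at hslope
      filter_upwards [hslope.abs.eventually_lt_const hr, self_mem_nhdsWithin] with z hz1 hz2
      refine lt_of_eq_of_lt ?_ hz1
      simp only [slope_def_field, h0, abs_zero, sub_zero, abs_div]
      rw [abs_of_pos (sub_pos.2 hz2)]
    · have hlt : 0 < (w t).arg := by
        refine lt_of_le_of_ne (Complex.arg_nonneg_iff.2 him.le) fun h => ?_
        exact him.ne' (Complex.arg_eq_zero_iff.1 h.symm).2
      have hev : ∀ᶠ u in 𝓝 t, 0 < (w u).arg := harg.continuousAt.eventually_const_lt hlt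
      rw [abs_of_pos him] at hr
      have h2 : l.im - (w t).im < r := by have := le_abs_self l.im; linarith
      filter_upwards [hslope.eventually_lt_const h2, nhdsWithin_le_nhds hev] with z hz1 hz2
      refine lt_of_eq_of_lt ?_ hz1
      simp only [slope_def_field, abs_of_pos hlt, abs_of_pos hz2]
  -- On the negative axis `|arg w|` has its maximal value `π`, so its right slopes are nonpositive.
  · rw [Complex.mem_slitPlane_iff, not_or, not_lt, not_not] at hs
    have hre : (w t).re < 0 := lt_of_le_of_ne hs.1 fun h => hw0 (Complex.ext h hs.2)
    have hpi : (w t).arg = Real.pi := Complex.arg_eq_pi_iff.2 ⟨hre, hs.2⟩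
    rw [hs.2, abs_zero, sub_zero] at hr
    filter_upwards [self_mem_nhdsWithin] with z hz
    refine lt_of_le_of_lt ?_ ((abs_nonneg _).trans_lt hr)
    simp only [slope_def_field, hpi, abs_of_pos Real.pi_pos]
    exact div_nonpos_of_nonpos_of_nonneg (sub_nonpos.2 (Complex.abs_arg_le_pi _))
      (sub_pos.2 hz).le

section

variable {γ d l : ℝ → ℂ} {t₀ : ℝ}

theorem IsRegularCurve.integral_le (h : IsRegularCurve γ t₀ d l) {a : ℂ}
    (ha : ∀ t, t₀ < t → γ t ≠ a) {x y : ℝ} (hx : t₀ < x) (hxy : x ≤ y) :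
    ∫ t in x..y, |(d t / (γ t - a)).im| ≤ (∫ t in x..y, |(l t).im|) + Real.pi := by
  set w : ℝ → ℂ := fun t => d t / (γ t - a) with hw
  have hne : ∀ t, t₀ < t → γ t - a ≠ 0 := fun t ht => sub_ne_zero.2 (ha t ht)
  have hw0 : ∀ t, t₀ < t → w t ≠ 0 := fun t ht => div_ne_zero (h.ne_zero t ht) (hne t ht)
  have hwd : ∀ t, t₀ < t → HasDerivAt w (w t * (l t - w t)) t := by
    intro t ht
    refine ((h.hasDerivAt_deriv t ht).div ((h.hasDerivAt t ht).sub_const a) (hne t ht)).congr_deriv ?_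
    have := hne t ht
    simp only [hw]
    field_simp
  have hwc : ContinuousOn w (Ioi t₀) := fun t ht => (hwd t ht).continuousAt.continuousWithinAt
  have hsub : Icc x y ⊆ Ioi t₀ := fun t ht => hx.trans_le ht.1
  have hc1 : ContinuousOn (fun t => |(w t).im|) (Ioi t₀) :=
    (Complex.continuous_im.comp_continuousOn hwc).abs
  have hc2 : ContinuousOn (fun t => |(l t).im|) (Ioi t₀) :=
    (Complex.continuous_im.comp_continuousOn h.continuousOn).abs
  have hi1 : ∀ t ∈ Icc x y, IntervalIntegrable (fun t => |(w t).im|) volume x t := fun t ht =>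
    (hc1.mono (by rw [uIcc_of_le ht.1]; exact (Icc_subset_Icc_right ht.2).trans hsub)).intervalIntegrable
  have hi2 : ∀ t ∈ Icc x y, IntervalIntegrable (fun t => |(l t).im|) volume x t := fun t ht =>
    (hc2.mono (by rw [uIcc_of_le ht.1]; exact (Icc_subset_Icc_right ht.2).trans hsub)).intervalIntegrable
  have hB : ∀ t ∈ Icc x y, HasDerivAt (fun t => |(w x).arg| +
      ((∫ u in x..t, |(l u).im|) - ∫ u in x..t, |(w u).im|)) (|(l t).im| - |(w t).im|) t := by
    intro t ht
    refine HasDerivAt.const_add _ (HasDerivAt.sub ?_ ?_)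
    · exact intervalIntegral.integral_hasDerivAt_right (hi2 t ht)
        (hc2.stronglyMeasurableAtFilter isOpen_Ioi t (hsub ht))
        (hc2.continuousAt (Ioi_mem_nhds (hsub ht)))
    · exact intervalIntegral.integral_hasDerivAt_right (hi1 t ht)
        (hc1.stronglyMeasurableAtFilter isOpen_Ioi t (hsub ht))
        (hc1.continuousAt (Ioi_mem_nhds (hsub ht)))
  -- Since `|arg w|` need not be differentiable, it is compared with its majorant through right
  -- slopes; the claim follows from `0 ≤ |arg w(y)|` and `|arg w(x)| ≤ π`.
  have key := image_le_of_liminf_slope_right_le_deriv_boundary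
    (f := fun t => |(w t).arg|) (a := x) (b := y)
    (fun t ht => ((continuousAt_abs_arg (hw0 t (hsub ht))).comp
      (hwd t (hsub ht)).continuousAt).continuousWithinAt)
    (by simp) (fun t ht => (hB t ht).continuousAt.continuousWithinAt)
    (fun t ht => (hB t (Ico_subset_Icc_self ht)).hasDerivWithinAt)
    (fun t ht r hr => frequently_slope_abs_arg_lt (hw0 t (hsub (Ico_subset_Icc_self ht)))
      (hwd t (hsub (Ico_subset_Icc_self ht))) hr) (right_mem_Icc.2 hxy)
  have h1 := Complex.abs_arg_le_pi (w x)
  have h2 := abs_nonneg (w y).arg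
  linarith

/-- Monotone exhaustion by compactly contained intervals, as nothing is assumed about integrability
near `t₀` or at infinity. -/
theorem setLIntegral_Ioi_le_of_forall_Ioc {f : ℝ → ENNReal} {C : ENNReal}
    (h : ∀ x y, t₀ < x → x ≤ y → ∫⁻ t in Ioc x y, f t ≤ C) : ∫⁻ t in Ioi t₀, f t ≤ C := by
  set S : ℕ → Set ℝ := fun n => Ioc (t₀ + 1 / ((n : ℝ) + 1)) (t₀ + 1 + n) with hS
  have hmono : Monotone S := by
    intro m n hmn
    have hmn' : (m : ℝ) ≤ n := by exact_mod_cast hmn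
    refine Ioc_subset_Ioc ?_ (by linarith)
    gcongr
  have hU : Ioi t₀ ⊆ ⋃ n, S n := by
    intro t ht
    obtain ⟨n, hn⟩ := exists_nat_one_div_lt (sub_pos.2 (show t₀ < t from ht))
    obtain ⟨m, hm⟩ := exists_nat_ge (t - t₀)
    refine mem_iUnion.2 ⟨max n m, lt_of_le_of_lt ?_ (lt_sub_iff_add_lt'.1 hn), ?_⟩
    · have : (n : ℝ) ≤ (max n m : ℕ) := by exact_mod_cast le_max_left n m
      gcongr
    · have : (m : ℝ) ≤ (max n m : ℕ) := by exact_mod_cast le_max_right n m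
      linarith
  refine (lintegral_mono_set hU).trans ?_
  rw [setLIntegral_iUnion_of_directed _ hmono.directed_le]
  refine iSup_le fun n => h _ _ (by have := Nat.one_div_pos_of_nat (α := ℝ) (n := n); linarith) ?_
  have h1 : 1 / ((n : ℝ) + 1) ≤ 1 := by
    rw [div_le_one (by positivity)]
    have := n.cast_nonneg (α := ℝ)
    linarith
  have := n.cast_nonneg (α := ℝ)
  linarith

/-- The variation of the argument of `γ - a` exceeds that of the argument of `γ'` by at most
half a turn. -/
theorem IsRegularCurve.lintegral_le (h : IsRegularCurve γ t₀ d l) {a : ℂ}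
    (ha : ∀ t, t₀ < t → γ t ≠ a) :
    ∫⁻ t in Ioi t₀, ENNReal.ofReal |(d t / (γ t - a)).im| ≤
      (∫⁻ t in Ioi t₀, ENNReal.ofReal |(l t).im|) + ENNReal.ofReal Real.pi := by
  refine setLIntegral_Ioi_le_of_forall_Ioc fun x y hx hxy => ?_
  have hsub : Icc x y ⊆ Ioi t₀ := fun t ht => hx.trans_le ht.1
  have hdc : ContinuousOn d (Ioi t₀) := fun t ht =>
    (h.hasDerivAt_deriv t ht).continuousAt.continuousWithinAt
  have hγc : ContinuousOn γ (Ioi t₀) := fun t ht =>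
    (h.hasDerivAt t ht).continuousAt.continuousWithinAt
  have hc1 : ContinuousOn (fun t => |(d t / (γ t - a)).im|) (Icc x y) :=
    (Complex.continuous_im.comp_continuousOn ((hdc.div (hγc.sub continuousOn_const)
      fun t ht => sub_ne_zero.2 (ha t ht)).mono hsub)).abs
  have hc2 : ContinuousOn (fun t => |(l t).im|) (Icc x y) :=
    (Complex.continuous_im.comp_continuousOn (h.continuousOn.mono hsub)).abs
  have hi1 := hc1.integrableOn_Icc.mono_set (μ := volume) Ioc_subset_Icc_self
  have hi2 := hc2.integrableOn_Icc.mono_set (μ := volume) Ioc_subset_Icc_self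
  have key := h.integral_le ha hx hxy
  rw [intervalIntegral.integral_of_le hxy, intervalIntegral.integral_of_le hxy] at key
  calc ∫⁻ t in Ioc x y, ENNReal.ofReal |(d t / (γ t - a)).im|
      = ENNReal.ofReal (∫ t in Ioc x y, |(d t / (γ t - a)).im|) :=
        (ofReal_integral_eq_lintegral_ofReal hi1 (Eventually.of_forall fun _ => abs_nonneg _)).symm
    _ ≤ ENNReal.ofReal (∫ t in Ioc x y, |(l t).im|) + ENNReal.ofReal Real.pi :=
        (ENNReal.ofReal_le_ofReal key).trans ENNReal.ofReal_add_le
    _ = (∫⁻ t in Ioc x y, ENNReal.ofReal |(l t).im|) + ENNReal.ofReal Real.pi := by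
        rw [ofReal_integral_eq_lintegral_ofReal hi2 (Eventually.of_forall fun _ => abs_nonneg _)]
    _ ≤ _ := by
        gcongr
        exact fun t ht => hx.trans ht.1

/-! ### Pullback of regular curves under the exponential map. -/

theorem image_modelF_Ioi (t₀ : ℝ) : modelF '' Ioi t₀ = Ioi (modelF t₀) := by
  ext u
  constructor
  · rintro ⟨t, ht, rfl⟩
    exact modelF_strictMono ht
  · intro hu
    have hu1 := modelF_log (modelF_add_one_pos_of_le (le_of_lt hu))
    exact ⟨Real.log (u + 1), modelF_strictMono.lt_iff_lt.1 (by rwa [hu1]), hu1⟩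

/-- A continuous lift under `exp` of a differentiable curve is differentiable. -/
theorem hasDerivAt_of_exp_eq {f g : ℝ → ℂ} {g' : ℂ} {t : ℝ} (hf : ContinuousAt f t)
    (hfg : ∀ᶠ u in 𝓝 t, Complex.exp (f u) = g u) (hg : HasDerivAt g g' t) :
    HasDerivAt f (g' / g t) t := by
  have ht : Complex.exp (f t) = g t := hfg.self_of_nhds
  have hgt : g t ≠ 0 := ht ▸ Complex.exp_ne_zero _
  have h1 : HasDerivAt (fun u => f t + Complex.log (g u / g t)) (g' / g t) t := by
    have h2 := hg.div_const (g t)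
    have h3 : g t / g t = 1 := div_self hgt
    have h4 := (h2.clog_real (by rw [h3]; exact Complex.one_mem_slitPlane)).const_add (f t)
    rwa [h3, div_one] at h4
  refine h1.congr_of_eventuallyEq ?_
  have hc : ContinuousAt (fun u => (f u - f t).im) t :=
    Complex.continuous_im.continuousAt.comp (hf.sub continuousAt_const)
  have hI : Ioo (-Real.pi) Real.pi ∈ 𝓝 ((f t - f t).im) := by
    rw [sub_self, Complex.zero_im]
    exact Ioo_mem_nhds (neg_lt_zero.2 Real.pi_pos) Real.pi_pos
  filter_upwards [hfg, hc hI] with u hu hu2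
  rw [← hu, ← ht, ← Complex.exp_sub, Complex.log_exp hu2.1 hu2.2.le]
  ring

/-- The lift has derivative `e^t (γ'/γ) ∘ F`; the new `l` is the logarithmic derivative of this
product. The denominator never vanishes because `γ ∘ F` is an exponential. -/
theorem IsRegularCurve.pullback {γ' : ℝ → ℂ} {κ : ℂ} (h : IsRegularCurve γ (modelF t₀) d l)
    (hc : ContinuousOn γ' (Ioi t₀))
    (he : ∀ t, t₀ < t → Complex.exp (γ' t + κ) = γ (modelF t)) :
    IsRegularCurve γ' t₀ (fun t => Real.exp t • (d (modelF t) / γ (modelF t)))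
      (fun t => 1 + Real.exp t • (l (modelF t) - d (modelF t) / γ (modelF t))) := by
  have hF : ∀ t, t₀ < t → modelF t₀ < modelF t := fun t ht => modelF_strictMono ht
  have hne : ∀ t, t₀ < t → γ (modelF t) ≠ 0 := fun t ht => he t ht ▸ Complex.exp_ne_zero _
  have hγ : ∀ t, t₀ < t →
      HasDerivAt (fun t => γ (modelF t)) (Real.exp t • d (modelF t)) t := fun t ht =>
    (h.hasDerivAt _ (hF t ht)).scomp t (hasDerivAt_modelF t)
  have hd : ∀ t, t₀ < t → HasDerivAt (fun t => d (modelF t))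
      (Real.exp t • (d (modelF t) * l (modelF t))) t := fun t ht =>
    (h.hasDerivAt_deriv _ (hF t ht)).scomp t (hasDerivAt_modelF t)
  refine ⟨fun t ht => ?_, fun t ht => ?_, fun t ht => ?_, ?_⟩
  · have h1 : HasDerivAt (fun t => γ' t + κ) _ t := hasDerivAt_of_exp_eq
      ((hc.continuousAt (Ioi_mem_nhds ht)).add continuousAt_const)
      (by filter_upwards [Ioi_mem_nhds ht] with u hu using he u hu) (hγ t ht)
    refine ((h1.sub_const κ).congr_of_eventuallyEq ?_).congr_deriv ?_
    · exact Eventually.of_forall fun u => by simp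
    · rw [smul_div_assoc]
  · exact smul_ne_zero (Real.exp_pos t).ne' (div_ne_zero (h.ne_zero _ (hF t ht)) (hne t ht))
  · refine ((Real.hasDerivAt_exp t).smul ((hd t ht).div (hγ t ht) (hne t ht))).congr_deriv ?_
    have := hne t ht
    simp only [Complex.real_smul, Pi.div_apply]
    field_simp
    ring
  · have hmaps : MapsTo modelF (Ioi t₀) (Ioi (modelF t₀)) := fun t ht => hF t ht
    have h1 : ContinuousOn (fun t => l (modelF t)) (Ioi t₀) :=
      h.continuousOn.comp continuous_modelF.continuousOn hmaps
    have h2 : ContinuousOn (fun t => d (modelF t) / γ (modelF t)) (Ioi t₀) := fun t ht =>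
      (((hd t ht).div (hγ t ht) (hne t ht)).continuousAt).continuousWithinAt
    exact continuousOn_const.add (Real.continuous_exp.continuousOn.smul (h1.sub h2))

/-- The summand `1` is real and `e^t` is the Jacobian of `F`. What remains is the variation of `l`
plus that of `γ'/γ`, the latter bounded by the half-turn estimate around the omitted value `0`. -/
theorem IsRegularCurve.lintegral_pullback_le {γ' : ℝ → ℂ} {κ : ℂ}
    (h : IsRegularCurve γ (modelF t₀) d l)
    (he : ∀ t, t₀ < t → Complex.exp (γ' t + κ) = γ (modelF t)) :
    ∫⁻ t in Ioi t₀, ENNReal.ofReal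
      |(1 + Real.exp t • (l (modelF t) - d (modelF t) / γ (modelF t))).im| ≤
    2 * (∫⁻ t in Ioi (modelF t₀), ENNReal.ofReal |(l t).im|) + ENNReal.ofReal Real.pi := by
  have h0 : ∀ u, modelF t₀ < u → γ u ≠ 0 := by
    intro u hu
    obtain ⟨t, ht, rfl⟩ := (image_modelF_Ioi t₀).ge hu
    exact he t ht ▸ Complex.exp_ne_zero _
  have hm : AEMeasurable (fun t => ENNReal.ofReal |(l t).im|)
      (volume.restrict (Ioi (modelF t₀))) :=
    ((Complex.continuous_im.comp_continuousOn h.continuousOn).abs.aemeasurable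
      measurableSet_Ioi).ennreal_ofReal
  have hlin := h.lintegral_le h0
  simp only [sub_zero] at hlin
  calc _ ≤ ∫⁻ t in Ioi t₀, ENNReal.ofReal |Real.exp t| *
        (ENNReal.ofReal |(l (modelF t)).im| +
          ENNReal.ofReal |(d (modelF t) / γ (modelF t)).im|) := by
        refine lintegral_mono fun t => ?_
        rw [← ENNReal.ofReal_add (abs_nonneg _) (abs_nonneg _), ← ENNReal.ofReal_mul (abs_nonneg _)]
        refine ENNReal.ofReal_le_ofReal ?_
        rw [Complex.add_im, Complex.one_im, zero_add, Complex.smul_im, Complex.sub_im, smul_eq_mul,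
          abs_mul]
        gcongr
        exact abs_sub _ _
    _ = ∫⁻ t in Ioi (modelF t₀), (ENNReal.ofReal |(l t).im| + ENNReal.ofReal |(d t / γ t).im|) := by
        rw [← image_modelF_Ioi, lintegral_image_eq_lintegral_abs_deriv_mul measurableSet_Ioi
          (fun t _ => (hasDerivAt_modelF t).hasDerivWithinAt) modelF_strictMono.injective.injOn]
    _ = (∫⁻ t in Ioi (modelF t₀), ENNReal.ofReal |(l t).im|) +
          ∫⁻ t in Ioi (modelF t₀), ENNReal.ofReal |(d t / γ t).im| := lintegral_add_left' hm _
    _ ≤ _ := by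
        rw [two_mul, add_assoc]
        gcongr

end

/-! ### Regularity of dynamic rays -/

section

variable {κ : ℂ} {s : ℕ → ℤ} {t₀ : ℝ}

/-- Every potential past `F^{∘(K+k)}(t₀)` is `F^{∘(K+k)}(t)` for some `t ≥ t₀`, so the limit
condition defining the ray supplies all tails at once. -/
theorem RayDefinedAt.isTailFamily (hs : ExpBounded s) (h : RayDefinedAt κ s t₀) :
    ∀ᶠ K in atTop, IsTailFamily κ (ExpRay.shift^[K] s) (modelF^[K] t₀)
      (fun i => dynRay κ (ExpRay.shift^[K + i] s)) := by
  obtain ⟨N, hN⟩ := eventually_atTop.1 h.isDynRayOn.tail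
  filter_upwards [exists_tailBound κ hs h.1, eventually_ge_atTop N] with K hK hKN
  have hadd : ∀ i, modelF^[i] (modelF^[K] t₀) = modelF^[K + i] t₀ := fun i => by
    rw [← Function.iterate_add_apply, add_comm]
  refine ⟨hK, fun k u hu => ?_, fun k => ?_⟩
  · rw [hadd] at hu
    obtain ⟨t, ht, rfl⟩ : ∃ t, t₀ ≤ t ∧ modelF^[K + k] t = u := by
      have himage := ((continuous_modelF_iterate (K + k)).continuousOn
        (s := Icc t₀ (max t₀ u)))
      obtain ⟨t, ht, htu⟩ := intermediate_value_Icc (le_max_left t₀ u) himage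
        ⟨hu, (le_max_right t₀ u).trans (le_iterate_modelF _ _)⟩
      exact ⟨t, ht.1, htu⟩
    rw [← Function.iterate_add_apply, add_comm k K, h.dynRay_iterate hs ht]
    exact hN (K + k) (by omega) t ht
  · rw [hadd]
    exact (h.shift_iterate hs (K + k)).isDynRayOn.continuousOn

theorem IsTailFamily.isRegularCurve {γ : ℕ → ℝ → ℂ} (h : IsTailFamily κ s t₀ γ) :
    IsRegularCurve (γ 0) t₀ (fun t => Complex.exp (-logSum κ s γ t))
      (fun t => -logSumDeriv κ s γ t) where
  hasDerivAt _ ht := h.hasDerivAt ht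
  ne_zero _ _ := Complex.exp_ne_zero _
  hasDerivAt_deriv _ ht := (h.hasDerivAt_logSum ht).neg.cexp
  continuousOn := h.continuousOn_logSumDeriv.neg.mono Ioi_subset_Ici_self

/-- The ray at address `σ^n s` is a regular curve if the one at address `σ^(n+k) s` is, and the
total variation of the argument of the derivative grows at most by a factor `2` with each
pullback, up to half a turn. -/
theorem RayDefinedAt.exists_regular_of_add (hs : ExpBounded s) (h : RayDefinedAt κ s t₀) (n k : ℕ)
    {d l : ℝ → ℂ}
    (hreg : IsRegularCurve (dynRay κ (ExpRay.shift^[n + k] s)) (modelF^[n + k] t₀) d l) :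
    ∃ d' l', IsRegularCurve (dynRay κ (ExpRay.shift^[n] s)) (modelF^[n] t₀) d' l' ∧
      (∫⁻ t in Ioi (modelF^[n] t₀), ENNReal.ofReal |(l' t).im|) + ENNReal.ofReal Real.pi ≤
        2 ^ k * ((∫⁻ t in Ioi (modelF^[n + k] t₀), ENNReal.ofReal |(l t).im|) +
          ENNReal.ofReal Real.pi) := by
  induction k generalizing d l with
  | zero => exact ⟨d, l, hreg, by simp⟩
  | succ k ih =>
    have hk := h.shift_iterate hs (n + k)
    have he : ∀ t, modelF^[n + k] t₀ < t →
        Complex.exp (dynRay κ (ExpRay.shift^[n + k] s) t + κ) =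
          dynRay κ (ExpRay.shift^[n + (k + 1)] s) (modelF t) := fun t ht => by
      rw [← add_assoc, Function.iterate_succ_apply']
      exact (hk.exp_dynRay (hs.shift_iterate _) ht.le).symm
    have hF : modelF^[n + (k + 1)] t₀ = modelF (modelF^[n + k] t₀) := by
      rw [← add_assoc, Function.iterate_succ_apply']
    rw [hF] at hreg ⊢
    obtain ⟨d', l', h1, h2⟩ := ih (hreg.pullback
      (hk.isDynRayOn.continuousOn.mono Ioi_subset_Ici_self) he)
    refine ⟨d', l', h1, h2.trans ?_⟩
    rw [pow_succ, mul_assoc]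
    gcongr
    -- Adding `π` makes the recursion homogeneous: `(2V + π) + π = 2 (V + π)`.
    refine (add_le_add_left (hreg.lintegral_pullback_le he) _).trans_eq ?_
    rw [mul_add, two_mul (ENNReal.ofReal Real.pi), add_assoc]

theorem RayDefinedAt.exists_regular (hs : ExpBounded s) (h : RayDefinedAt κ s t₀) (n : ℕ) :
    ∃ d l, IsRegularCurve (dynRay κ (ExpRay.shift^[n] s)) (modelF^[n] t₀) d l := by
  obtain ⟨K, hK, hnK⟩ := ((h.isTailFamily hs).and (eventually_ge_atTop n)).exists
  obtain ⟨k, rfl⟩ := Nat.exists_eq_add_of_le hnK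
  obtain ⟨d, l, hdl, -⟩ := h.exists_regular_of_add hs n k hK.isRegularCurve
  exact ⟨d, l, hdl⟩

/-- Equal points have equal iterates. But at a high level each is within `1/2` of its asymptotic
value, and these values differ by `F^{∘K}(t) - F^{∘K}(t₀) > 1`. -/
theorem RayDefinedAt.dynRay_ne (hs : ExpBounded s) (h : RayDefinedAt κ s t₀) {t : ℝ}
    (ht : t₀ < t) : dynRay κ s t ≠ dynRay κ s t₀ := by
  intro heq
  obtain ⟨x, hx, hxt, -⟩ := hs.exists_lt h.1
  have hlim := tendsto_iterate_modelF_sub (hx.trans hxt) ht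
  obtain ⟨K, hK, hK1⟩ := ((h.isTailFamily hs).and (hlim.eventually_gt_atTop 1)).exists
  have hstrict := (iterate_modelF_strictMono K) ht
  have e1 := hK.tailErr_le' le_rfl 0
  have e2 := hK.tailErr_le' hstrict.le 0
  have hval : dynRay κ (ExpRay.shift^[K] s) (modelF^[K] t) =
      dynRay κ (ExpRay.shift^[K] s) (modelF^[K] t₀) := by
    rw [h.dynRay_iterate hs ht.le, h.dynRay_iterate hs le_rfl, heq]
  simp only [tailErr, Function.iterate_zero_apply, add_zero, hval] at e1 e2
  have h3 : ((modelF^[K] t - modelF^[K] t₀ : ℝ) : ℂ) =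
      (dynRay κ (ExpRay.shift^[K] s) (modelF^[K] t₀) -
        (modelF^[K] t₀ - κ + 2 * Real.pi * Complex.I * ((ExpRay.shift^[K] s) 0 : ℂ))) -
      (dynRay κ (ExpRay.shift^[K] s) (modelF^[K] t₀) -
        (modelF^[K] t - κ + 2 * Real.pi * Complex.I * ((ExpRay.shift^[K] s) 0 : ℂ))) := by
    push_cast; ring
  have h4 := norm_sub_le (dynRay κ (ExpRay.shift^[K] s) (modelF^[K] t₀) -
        (modelF^[K] t₀ - κ + 2 * Real.pi * Complex.I * ((ExpRay.shift^[K] s) 0 : ℂ)))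
      (dynRay κ (ExpRay.shift^[K] s) (modelF^[K] t₀) -
        (modelF^[K] t - κ + 2 * Real.pi * Complex.I * ((ExpRay.shift^[K] s) 0 : ℂ)))
  rw [← h3, Complex.norm_real, Real.norm_of_nonneg (by linarith)] at h4
  norm_num at e1 e2
  linarith

end

/-! ### From regular curves to the stated hypothesis and conclusion. -/

theorem IsRegularCurve.deriv_deriv_div {γ d l : ℝ → ℂ} {t₀ t : ℝ} (h : IsRegularCurve γ t₀ d l)
    (ht : t₀ < t) : deriv (deriv γ) t / deriv γ t = l t := by
  have h1 : deriv γ =ᶠ[𝓝 t] d := by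
    filter_upwards [Ioi_mem_nhds ht] with u hu using (h.hasDerivAt u hu).deriv
  rw [h1.deriv_eq, (h.hasDerivAt_deriv t ht).deriv, (h.hasDerivAt t ht).deriv]
  have := h.ne_zero t ht
  field_simp

theorem IsRegularCurve.contDiffOn {γ d l : ℝ → ℂ} {t₀ : ℝ} (h : IsRegularCurve γ t₀ d l) :
    ContDiffOn ℝ 1 γ (Ioi t₀) := by
  rw [show (1 : WithTop ℕ∞) = 0 + 1 by simp, contDiffOn_succ_iff_deriv_of_isOpen isOpen_Ioi]
  refine ⟨fun t ht => (h.hasDerivAt t ht).differentiableAt.differentiableWithinAt, by simp, ?_⟩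
  rw [contDiffOn_zero]
  refine ContinuousOn.congr (f := d) (fun t ht =>
    (h.hasDerivAt_deriv t ht).continuousAt.continuousWithinAt) fun t ht => (h.hasDerivAt t ht).deriv

theorem lintegral_exp_neg_half_le {t₀ : ℝ} (ht₀ : 0 ≤ t₀) :
    ∫⁻ t in Ioi t₀, ENNReal.ofReal (Real.exp (-t / 2)) ≤ ENNReal.ofReal 2 := by
  have h1 : ∀ t : ℝ, Real.exp (-t / 2) = Real.exp (-(1 / 2) * t) := fun t => by ring_nf
  simp_rw [h1]
  rw [← ofReal_integral_eq_lintegral_ofReal (integrableOn_exp_mul_Ioi (by norm_num) t₀)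
    (Eventually.of_forall fun _ => (Real.exp_pos _).le), integral_exp_mul_Ioi (by norm_num)]
  refine ENNReal.ofReal_le_ofReal ?_
  have : Real.exp (-(1 / 2) * t₀) ≤ 1 := Real.exp_le_one_iff.2 (by linarith)
  linarith

end ExpRay
end

theorem proposition4p12 (κ : ℂ) (s : ℕ → ℤ) (hs : ExpRay.ExpBounded s)
    (t₀ : ℝ) (ht₀ : ExpRay.RayDefinedAt κ s t₀)
    (z : ℂ) (hz : z = ExpRay.dynRay κ s t₀) (N : ℕ)
    (hN : ∀ t : ℝ, ExpRay.modelF^[N] t₀ ≤ t →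
      ‖deriv (deriv (ExpRay.dynRay κ (ExpRay.shift^[N] s))) t
        / deriv (ExpRay.dynRay κ (ExpRay.shift^[N] s)) t‖ < Real.exp (-t / 2)) :
    ContDiffOn ℝ 1 (ExpRay.dynRay κ s) (Set.Ioi t₀) ∧
    z ∉ ExpRay.dynRay κ s '' Set.Ioi t₀ ∧
    ExpRay.variationNumber (ExpRay.dynRay κ s) t₀ z ≤ 2 ^ N := by
  -- Regularity at level `N` comes from a tail much further out. The variation estimate starts
  -- afresh at level `N`, where the hypothesis bounds `l`.
  obtain ⟨d, l, hdl⟩ := ht₀.exists_regular hs N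
  obtain ⟨d₀, l₀, hreg, hvar⟩ := ht₀.exists_regular_of_add hs 0 N (by rwa [zero_add])
  simp only [zero_add, Function.iterate_zero_apply] at hreg hvar
  have hne : ∀ t, t₀ < t → ExpRay.dynRay κ s t ≠ z := fun t ht => hz ▸ ht₀.dynRay_ne hs ht
  refine ⟨hreg.contDiffOn, ?_, ?_⟩
  · rintro ⟨t, ht, h⟩
    exact hne t ht h
  have hpos : 0 ≤ ExpRay.modelF^[N] t₀ := by
    obtain ⟨x, hx, hxt, -⟩ := hs.exists_lt ht₀.1
    exact (hx.trans hxt).le.trans (ExpRay.le_iterate_modelF N t₀)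
  have hl : ∫⁻ t in Ioi (ExpRay.modelF^[N] t₀), ENNReal.ofReal |(l t).im| ≤ ENNReal.ofReal 2 := by
    refine le_trans (setLIntegral_mono' measurableSet_Ioi fun t ht => ?_)
      (ExpRay.lintegral_exp_neg_half_le hpos)
    refine ENNReal.ofReal_le_ofReal ((Complex.abs_im_le_norm _).trans ?_)
    rw [← hdl.deriv_deriv_div ht]
    exact (hN t (le_of_lt ht)).le
  have hpi := Real.pi_gt_three
  have hd : ∫⁻ t in Ioi t₀, ENNReal.ofReal
      |(deriv (ExpRay.dynRay κ s) t / (ExpRay.dynRay κ s t - z)).im| ≤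
      2 ^ N * ENNReal.ofReal (2 * Real.pi) := by
    calc _ = ∫⁻ t in Ioi t₀, ENNReal.ofReal |(d₀ t / (ExpRay.dynRay κ s t - z)).im| :=
          setLIntegral_congr_fun measurableSet_Ioi fun t ht => by
            simp only [(hreg.hasDerivAt t ht).deriv]
      _ ≤ _ := hreg.lintegral_le hne
      _ ≤ _ := hvar
      _ ≤ 2 ^ N * (ENNReal.ofReal 2 + ENNReal.ofReal Real.pi) := by gcongr
      -- Here `2 + π ≤ 2π`; this is where the clean constant `2^N` comes from.
      _ ≤ _ := by
        gcongr
        rw [← ENNReal.ofReal_add (by norm_num) (by linarith)]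
        exact ENNReal.ofReal_le_ofReal (by linarith)
  calc _ ≤ ENNReal.ofReal (1 / (2 * Real.pi)) * (2 ^ N * ENNReal.ofReal (2 * Real.pi)) :=
        mul_le_mul_right hd _
    _ = 2 ^ N * ENNReal.ofReal (1 / (2 * Real.pi) * (2 * Real.pi)) := by
        rw [ENNReal.ofReal_mul (p := 1 / (2 * Real.pi)) (by positivity)]
        ring
    _ = 2 ^ N := by
        rw [one_div, inv_mul_cancel₀ (by positivity), ENNReal.ofReal_one, mul_one]
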